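/- Consider the impulsive hematopoiesis model $$\dot x(t)=-a(t)x(t)+\frac{b(t)}{1+x^{\alpha}(t-\tau)},\quad t\ne t_k,\qquad x(t_k^+)-x(t_k^-)=\gamma_k x(t_k^-)+\delta_k,\quad k\in\mathbb Z, \tag{1}$$ with constants $\alpha>0$, $\tau\ge 0$, functions $a,b:\mathbb R\to\mathbb R$ and real sequences $(t_k),(\gamma_k),(\delta_k)$ indexed by $k\in\mathbb Z$. Write $f_L,f_M$ for the infimum and supremum of a bounded function or sequence $f$. Assume: * $a$ is almost periodic in the sense of Bohr and $a_L>0$; $b$ is nonnegative and almost periodic in the sense of Bohr; * $(\delta_k)$ is an almost periodic sequence; * $(\gamma_k)$ is an almost periodic sequence with $\gamma_L>-1$, and, with $\Gamma(q,p)=\prod_{i=q}^{p}(1+\gamma_i)$ for $p\ge q$, $\Gamma_M=\sup_{p\ge q}\Gamma(q,p)<\infty$ and $\Gamma_L=\inf_{p\ge q}\Gamma(q,p)>0$; * the sequences $(t_{k+p}-t_k)_{k\in\mathbb Z}$, $p\in\mathbb Z$, are uniformly almost periodic (for every $\epsilon>0$ there is a relatively dense set of $\epsilon$-almost periods common to all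 of them), and $\eta=\inf_k(t_{k+1}-t_k)>0$. Put $\bar\eta=\sup_k(t_{k+1}-t_k)$, $A=\max\{\Gamma_M,1\}$, $B=\min\{\Gamma_L,1\}$, $$M_1=\frac{A\,b_M}{a_L}+\frac{A\max\{\delta_M,0\}}{1-e^{-a_L\eta}},\qquad M_2=\frac{B}{a_M}\,\frac{b_L}{1+M_1^{\alpha}}+\begin{cases}\dfrac{B\,\delta_L e^{-a_M\bar\eta}}{1-e^{-a_M\bar\eta}},&\delta_L\ge 0,\\[2mm] \dfrac{A\,\delta_L}{1-e^{-a_L\eta}},&\delta_L<0,\end{cases}$$ and $K^*=\sup_{M_2\le x\le M_1}\alpha x^{\alpha-1}$. Suppose that $M_2>0$, $\tau\le\eta$ and $$\frac1{a_L}\max\{A,(\gamma_L+1)^{-1}\}\,b_M K^*<1 .$$ Solutions take values in $[0,\infty)$, are left continuous, are continuous except at the $t_k$, where they have right limits and satisfy the jump condition, and satisfy the differential equation at every $t$ (with $t>t_0$ for a solution started at time $t_0$) such that neither $t$ nor $t-\tau$ is one of the $t_k$. Such a function $\phi$ on $\mathbb R$ is called almost periodic if for every $\epsilon>0$ (i)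 there is $d>0$ with $|\phi(t)-\phi(t')|<\epsilon$ whenever $t,t'$ lie in one interval $(t_k,t_{k+1}]$ and $|t-t'|<d$, and (ii) the set of $\omega$ such that $|\phi(t+\omega)-\phi(t)|<\epsilon$ for all $t$ with $|t-t_k|>\epsilon$ for every $k$ is relatively dense in $\mathbb R$. Then (1) has exactly one almost periodic solution $x^*$ on $\mathbb R$ with $x^*(t)>0$ for all $t$. Moreover $x^*$ is (globally) exponentially stable: there are constants $C,\lambda>0$ such that for every $t_0\in\mathbb R$ and every solution $x$ of (1) on $[t_0-\tau,\infty)$ starting at time $t_0$ from an initial function on $[t_0-\tau,t_0]$ (nonnegative, positive at $t_0$, left continuous, with discontinuities only at instants $t_k$, where the right limits exist; the jump condition is imposed at all $t_k\ge t_0$), $$|x(t)-x^*(t)|\le C\,e^{-\lambda(t-t_0)}\sup_{t_0-\tau\le s\le t_0}|x(s)-x^*(s)|,\qquad t\ge t_0 .$$ -/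

import Mathlib

open Set Filter Topology

noncomputable section

/-- Relatively dense set of reals: for some length `l`, every closed interval of length `l`
meets the set. -/
def RelDenseReal (S : Set ℝ) : Prop :=
  ∃ l : ℝ, 0 < l ∧ ∀ u : ℝ, ∃ w ∈ S, u ≤ w ∧ w ≤ u + l

/-- Relatively dense set of integers. -/
def RelDenseInt (S : Set ℤ) : Prop :=
  ∃ l : ℕ, ∀ n : ℤ, ∃ p ∈ S, n ≤ p ∧ p ≤ n + l

/-- Almost periodicity in the sense of Bohr. -/
def BohrAP (f : ℝ → ℝ) : Prop :=
  Continuous f ∧ ∀ ε : ℝ, 0 < ε → RelDenseReal {w | ∀ t, |f (t + w) - f t| < ε}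

/-- Almost periodic two-sided real sequence. -/
def SeqAP (z : ℤ → ℝ) : Prop :=
  ∀ ε : ℝ, 0 < ε → RelDenseInt {p | ∀ k, |z (k + p) - z k| < ε}

/-- The family of sequences `k ↦ t (k + p) - t k`, `p ∈ ℤ`, is uniformly almost periodic: for each
`ε` there is a relatively dense set of `ε`-almost periods common to all of these sequences. -/
def UniformlyAP (t : ℤ → ℝ) : Prop :=
  ∀ ε : ℝ, 0 < ε →
    RelDenseInt {q | ∀ p k, |(t (k + q + p) - t (k + q)) - (t (k + p) - t k)| < ε}

/-- The space `PLC(X, ℝ)` relative to the instants `t k`: `φ` is left continuous on `X`,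
continuous at all points of `X` other than the instants, and its right limits at the instants
exist (as finite numbers). Only the values of `φ` on `X` matter. -/
structure PLC (t : ℤ → ℝ) (X : Set ℝ) (φ : ℝ → ℝ) : Prop where
  left_cont : ∀ s ∈ X, ContinuousWithinAt φ (X ∩ Iic s) s
  cont : ∀ s ∈ X, s ∉ range t → ContinuousWithinAt φ X s
  right_lim : ∀ k, t k ∈ X → ∃ l : ℝ, Tendsto φ (𝓝[X ∩ Ioi (t k)] (t k)) (𝓝 l)

/-- Almost periodicity of a piecewise left continuous function with discontinuities at the
instants `t k`. -/
structure PiecewiseAP (t : ℤ → ℝ) (φ : ℝ → ℝ) : Prop where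
  plc : PLC t univ φ
  instants : UniformlyAP t
  unif_cont : ∀ ε : ℝ, 0 < ε → ∃ d : ℝ, 0 < d ∧ ∀ k : ℤ,
    ∀ s ∈ Ioc (t k) (t (k + 1)), ∀ s' ∈ Ioc (t k) (t (k + 1)), |s - s'| < d → |φ s - φ s'| < ε
  almost_periods : ∀ ε : ℝ, 0 < ε →
    RelDenseReal {w | ∀ s, (∀ k, ε < |s - t k|) → |φ (s + w) - φ s| < ε}

/-- The data of the impulsive hematopoiesis model
`x'(s) = -a(s) x(s) + b(s) / (1 + x(s - τ) ^ α)` for `s ≠ t k`, with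
`x(t k +) - x(t k -) = γ k * x(t k -) + δ k` for `k ∈ ℤ`. -/
structure HematopoiesisModel where
  a : ℝ → ℝ
  b : ℝ → ℝ
  τ : ℝ
  α : ℝ
  t : ℤ → ℝ
  γ : ℤ → ℝ
  δ : ℤ → ℝ

namespace HematopoiesisModel

variable (P : HematopoiesisModel)

/-- Right-hand side of the differential equation at time `s`. -/
def rhs (x : ℝ → ℝ) (s : ℝ) : ℝ :=
  -P.a s * x s + P.b s / (1 + x (s - P.τ) ^ P.α)

/-- Solutions on the whole line. The state space is `[0, ∞)`, where the real power makes sense.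
A jump of `x` at `t k` makes the right-hand side jump at `t k + τ`, where `x` is continuous but has
only one-sided derivatives; the equation is required at all other times that are not impulse
instants. As `x` is left continuous, `x (t k)` is the left limit at `t k`. -/
structure IsSolution (x : ℝ → ℝ) : Prop where
  plc : PLC P.t univ x
  nonneg : ∀ s, 0 ≤ x s
  ode : ∀ s, s ∉ range P.t → s - P.τ ∉ range P.t → HasDerivAt x (P.rhs x s) s
  jump : ∀ k, Tendsto x (𝓝[>] (P.t k)) (𝓝 (x (P.t k) + (P.γ k * x (P.t k) + P.δ k)))

/-- Solutions `x` on `[t₀ - τ, ∞)` of the initial value problem at time `t₀`, whose initial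
function, the restriction of `x` to `[t₀ - τ, t₀]`, lies in `PLC`, is nonnegative, and is positive
at `t₀`. -/
structure IsSolutionFrom (t₀ : ℝ) (x : ℝ → ℝ) : Prop where
  plc : PLC P.t (Ici (t₀ - P.τ)) x
  nonneg : ∀ s, t₀ - P.τ ≤ s → 0 ≤ x s
  init_pos : 0 < x t₀
  ode : ∀ s, t₀ < s → s ∉ range P.t → s - P.τ ∉ range P.t → HasDerivAt x (P.rhs x s) s
  jump : ∀ k, t₀ ≤ P.t k →
    Tendsto x (𝓝[>] (P.t k)) (𝓝 (x (P.t k) + (P.γ k * x (P.t k) + P.δ k)))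

/-- Positive almost periodic solutions. -/
def IsPositiveAPSolution (x : ℝ → ℝ) : Prop :=
  P.IsSolution x ∧ PiecewiseAP P.t x ∧ ∀ s, 0 < x s

/-- (Global) exponential stability of the solution `x`: with constants `C`, `c` independent of
the initial time and of the initial function, every solution `y` of an initial value problem
satisfies `|y s - x s| ≤ C * (sup of |y - x| over [t₀ - τ, t₀]) * exp (-c * (s - t₀))`. The
supremum is expressed by its upper bounds `r`. -/
def IsExpStable (x : ℝ → ℝ) : Prop :=
  ∃ C c : ℝ, 0 < C ∧ 0 < c ∧ ∀ (t₀ : ℝ) (y : ℝ → ℝ), P.IsSolutionFrom t₀ y →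
    ∀ r : ℝ, (∀ s ∈ Icc (t₀ - P.τ) t₀, |y s - x s| ≤ r) →
      ∀ s, t₀ ≤ s → |y s - x s| ≤ C * r * Real.exp (-c * (s - t₀))

def aL : ℝ := ⨅ s, P.a s
def aM : ℝ := ⨆ s, P.a s
def bL : ℝ := ⨅ s, P.b s
def bM : ℝ := ⨆ s, P.b s
def γL : ℝ := ⨅ k, P.γ k
def δL : ℝ := ⨅ k, P.δ k
def δM : ℝ := ⨆ k, P.δ k

/-- `η`, the infimum of the gaps between consecutive instants. -/
def η : ℝ := ⨅ k, (P.t (k + 1) - P.t k)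

/-- The supremum of the gaps between consecutive instants. -/
def ηbar : ℝ := ⨆ k, (P.t (k + 1) - P.t k)

/-- The set of all products `Γ(q, p) = ∏_{i = q}^{p} (1 + γ i)` with `q ≤ p`. -/
def gammaProducts : Set ℝ :=
  {g | ∃ q p : ℤ, q ≤ p ∧ g = ∏ i ∈ Finset.Icc q p, (1 + P.γ i)}

def ΓM : ℝ := sSup P.gammaProducts
def ΓL : ℝ := sInf P.gammaProducts

def A : ℝ := max P.ΓM 1
def B : ℝ := min P.ΓL 1

def M₁ : ℝ :=
  P.A / P.aL * P.bM + P.A * max P.δM 0 / (1 - Real.exp (-P.aL * P.η))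

open Classical in
def M₂ : ℝ :=
  P.B / P.aM * (P.bL / (1 + P.M₁ ^ P.α)) +
    if 0 ≤ P.δL then
      P.B * P.δL * Real.exp (-P.aM * P.ηbar) / (1 - Real.exp (-P.aM * P.ηbar))
    else P.A * P.δL / (1 - Real.exp (-P.aL * P.η))

/-- `K* = sup { α x ^ (α - 1) : M₂ ≤ x ≤ M₁ }`. -/
def Kstar : ℝ := sSup ((fun x : ℝ => P.α * x ^ (P.α - 1)) '' Icc P.M₂ P.M₁)

end HematopoiesisModel

end

/-! Put `W(s, r) = exp (logFund s - logFund r)`, the propagator of the linear impulsive equation `x'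
= -a x`, `x ↦ (1 + γ k) x`. All products `Γ(q, p)`, and the empty product, lie in `[B, A]`, so `B
e^{-aM (s - r)} ≤ W(s, r) ≤ A e^{-aL (s - r)}` for `r ≤ s`. Variation of constants from `-∞`
therefore converges and turns the model into the fixed point equation `x = op x`, where `op x s =
∫_{-∞}^s W(s, r) feed x r dr + jumpResponse s` and `jumpResponse` sums the propagated jumps `δ`.

Existence. The Hill function `1 / (1 + v ^ α)` is decreasing with values in `(0, 1]`. The bounds on
`W` then give `op x ≤ M₁` for nonnegative `x`, and `op x ≥ M₂` if moreover `x ≤ M₁` (`op_le`,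
`le_op`). On `[M₂, M₁]` the Hill function has Lipschitz constant `lip M₂ M₁ ≤ K*`, so `op` contracts
the sup distance by `θ = A bM lip / aL < 1`. Picard iteration gives a fixed point, and it is a
solution (`exists_fixed_point`, `isSolution_of_fixed_point`).

Almost periodicity is proved for the fixed point itself, not through an invariant space of almost
periodic functions. Let `w` be an `ε`-almost period of all the data at once. If `x` moves by at most
`D` under the shift `w`, outside the `ε`-neighbourhoods of the instants, then `x = op x` shows that
it moves there by at most `θ D + C ε`: the neighbourhoods carry only `O(ε)` of the exponential
weight (`exists_shift_bound`). Iterating from `D = M₁` leaves `C ε / (1 - θ)`. A pigeonhole argument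
over the instants makes the common periods relatively dense (`relDense_commonPeriod`).

Stability. The difference of two solutions satisfies an integral inequality, and `mild_diff_le`
iterates it into an exponential bound. The contraction constant is available only once the perturbed
solution has entered a slight enlargement of `[M₂, M₁]`, which happens after a time depending on the
size of its initial value (`exists_absorption`). Until then a cruder Lipschitz constant gives
controlled growth. Very large initial deviations first decay at the linear rate `aL`, which exceeds
the final rate, so the constants can be made uniform (`isExpStable`).

Uniqueness. A positive almost periodic solution stays below `M₁`, because its value at one point
nearly recurs arbitrarily far in the past. Two such solutions are then within `M₁` of each other at
all past times, and stability from initial time `s - T` with `T → ∞` identifies them. -/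

noncomputable section

/-! ### Almost periods common to several functions and sequences. -/

/-- Precompactness of the `ℤ`-indexed family whose members `m`, `m'` are `ε`-close when
`R ε m m'`: finitely many classes of diameter at most `ε` cover the index set. -/
def FinitelyColored (R : ℝ → ℤ → ℤ → Prop) : Prop :=
  ∀ ε : ℝ, 0 < ε → ∃ (n : ℕ) (c : ℤ → Fin n), ∀ m m', c m = c m' → R ε m m'

lemma FinitelyColored.and {R S : ℝ → ℤ → ℤ → Prop} (hR : FinitelyColored R)
    (hS : FinitelyColored S) : FinitelyColored fun ε m m' => R ε m m' ∧ S ε m m' := by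
  intro ε hε
  obtain ⟨n, c, hc⟩ := hR ε hε
  obtain ⟨n', c', hc'⟩ := hS ε hε
  refine ⟨n * n', fun m => finProdFinEquiv (c m, c' m), fun m m' h => ?_⟩
  have h := finProdFinEquiv.injective h
  exact ⟨hc _ _ (congrArg Prod.fst h), hc' _ _ (congrArg Prod.snd h)⟩

/-- The colour of `m` is its remainder modulo the relatively dense set: its distance to an element
of `S` in `[m - l, m]`. -/
lemma exists_coloring_of_relDenseInt {S : Set ℤ} (hS : RelDenseInt S) :
    ∃ (n : ℕ) (c : ℤ → Fin n), ∀ m, m - (c m : ℤ) ∈ S := by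
  obtain ⟨l, hl⟩ := hS
  choose p hp h1 h2 using fun m : ℤ => hl (m - l)
  refine ⟨l + 1, fun m => ⟨(m - p m).toNat, ?_⟩, fun m => ?_⟩
  · have := h1 m; have := h2 m; omega
  · have h : m - ((m - p m).toNat : ℤ) = p m := by have := h2 m; omega
    change m - ((m - p m).toNat : ℤ) ∈ S
    rw [h]
    exact hp m

lemma SeqAP.finitelyColored {z : ℤ → ℝ} (hz : SeqAP z) :
    FinitelyColored fun ε m m' => ∀ k, |z (k + m) - z (k + m')| < ε := by
  intro ε hε
  obtain ⟨n, c, hc⟩ := exists_coloring_of_relDenseInt (hz (ε / 2) (half_pos hε))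
  refine ⟨n, c, fun m m' h k => ?_⟩
  have h1 := hc m (k + c m)
  have h2 := hc m' (k + c m)
  rw [show k + (c m : ℤ) + (m - c m) = k + m by ring] at h1
  rw [h, show k + (c m' : ℤ) + (m' - c m') = k + m' by ring, ← h] at h2
  rw [abs_lt] at *
  constructor <;> linarith [h1.1, h1.2, h2.1, h2.2]

/-- The almost period `m - c m`, applied at the index `c m`, compares the instants seen from `t m`
with those seen from `t (c m)`, up to `ε / 2`. -/
lemma UniformlyAP.finitelyColored {t : ℤ → ℝ} (ht : UniformlyAP t) :
    FinitelyColored fun ε m m' => ∀ p, |(t (m + p) - t m) - (t (m' + p) - t m')| < ε := by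
  intro ε hε
  obtain ⟨n, c, hc⟩ := exists_coloring_of_relDenseInt (ht (ε / 2) (half_pos hε))
  refine ⟨n, c, fun m m' h p => ?_⟩
  have h1 := hc m p (c m)
  have h2 := hc m' p (c m)
  rw [show (c m : ℤ) + (m - c m) = m by ring] at h1
  rw [h, show (c m' : ℤ) + (m' - c m') = m' by ring, ← h] at h2
  rw [abs_lt] at *
  constructor <;> linarith [h1.1, h1.2, h2.1, h2.2]

lemma UniformlyAP.seqAP_gap {t : ℤ → ℝ} (ht : UniformlyAP t) :
    SeqAP fun k => t (k + 1) - t k := by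
  intro ε hε
  obtain ⟨l, hl⟩ := ht ε hε
  refine ⟨l, fun n => ?_⟩
  obtain ⟨q, hq, h⟩ := hl n
  exact ⟨q, fun k => hq 1 k, h⟩

lemma SeqAP.bounded {z : ℤ → ℝ} (hz : SeqAP z) : ∃ C, ∀ k, |z k| ≤ C := by
  obtain ⟨l, hl⟩ := hz 1 one_pos
  obtain ⟨C, hC⟩ := ((finite_Icc (0 : ℤ) l).image fun k => |z k|).bddAbove
  refine ⟨C + 1, fun k => ?_⟩
  obtain ⟨p, hp, h1, h2⟩ := hl (-k)
  have h3 := hp k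
  have h4 := hC (mem_image_of_mem _ (show k + p ∈ Icc (0 : ℤ) l from ⟨by omega, by omega⟩))
  have h5 := abs_sub_abs_le_abs_sub (z k) (z (k + p))
  rw [abs_sub_comm] at h5
  linarith

lemma BohrAP.bounded {f : ℝ → ℝ} (hf : BohrAP f) : ∃ C, ∀ s, |f s| ≤ C := by
  obtain ⟨l, hl, h⟩ := hf.2 1 one_pos
  obtain ⟨C, hC⟩ := (isCompact_Icc (a := (0 : ℝ)) (b := l)).bddAbove_image hf.1.abs.continuousOn
  refine ⟨C + 1, fun s => ?_⟩
  obtain ⟨p, hp, h1, h2⟩ := h (-s)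
  have h3 := hp s
  have h4 := hC (mem_image_of_mem _ (show s + p ∈ Icc (0 : ℝ) l from ⟨by linarith, by linarith⟩))
  have h5 := abs_sub_abs_le_abs_sub (f s) (f (s + p))
  rw [abs_sub_comm] at h5
  linarith

lemma BohrAP.unif_cont {f : ℝ → ℝ} (hf : BohrAP f) {ε : ℝ} (hε : 0 < ε) :
    ∃ d, 0 < d ∧ ∀ s s', |s - s'| < d → |f s - f s'| < ε := by
  obtain ⟨l, hl, h⟩ := hf.2 (ε / 3) (by positivity)
  have hu := (isCompact_Icc (a := (-1 : ℝ)) (b := l + 1)).uniformContinuousOn_of_continuous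
    hf.1.continuousOn
  obtain ⟨d, hd, hdu⟩ := Metric.uniformContinuousOn_iff.1 hu (ε / 3) (by positivity)
  refine ⟨min d 1, lt_min hd one_pos, fun s s' hs => ?_⟩
  obtain ⟨p, hp, h1, h2⟩ := h (-s)
  have hs1 := abs_lt.1 (hs.trans_le (min_le_right _ _))
  have h3 := hdu (s + p) ⟨by linarith, by linarith⟩ (s' + p)
    ⟨by linarith [hs1.1, hs1.2], by linarith [hs1.1, hs1.2]⟩
    (by rw [Real.dist_eq]; simpa using hs.trans_le (min_le_left _ _))
  rw [Real.dist_eq] at h3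
  have h4 := hp s
  have h5 := hp s'
  rw [abs_lt] at *
  constructor <;> linarith [h3.1, h3.2, h4.1, h4.2, h5.1, h5.2]

/-- Modulo an almost period, `t m` reduces to a remainder in `[0, l]`. The colour is the cell of
length `d` containing this remainder, with `d` taken from uniform continuity. -/
lemma BohrAP.finitelyColored {f : ℝ → ℝ} (hf : BohrAP f) (t : ℤ → ℝ) :
    FinitelyColored fun ε m m' => ∀ s, |f (s + t m) - f (s + t m')| < ε := by
  intro ε hε
  obtain ⟨l, hl, h⟩ := hf.2 (ε / 3) (by positivity)
  obtain ⟨d, hd, hu⟩ := hf.unif_cont (show 0 < ε / 3 by positivity)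
  choose p hp h1 h2 using fun m : ℤ => h (t m - l)
  have hpos : ∀ m, 0 ≤ (t m - p m) / d := fun m => div_nonneg (by linarith [h2 m]) hd.le
  refine ⟨⌊l / d⌋₊ + 1, fun m => ⟨⌊(t m - p m) / d⌋₊, ?_⟩, fun m m' hm s => ?_⟩
  · refine Nat.lt_succ_of_le (Nat.floor_le_floor ?_)
    gcongr
    linarith [h1 m]
  · have hm : ⌊(t m - p m) / d⌋₊ = ⌊(t m' - p m') / d⌋₊ := congrArg Fin.val hm
    have e1 := Nat.floor_le (hpos m)
    have e2 := Nat.lt_floor_add_one ((t m - p m) / d)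
    have e3 := Nat.floor_le (hpos m')
    have e4 := Nat.lt_floor_add_one ((t m' - p m') / d)
    rw [← hm] at e3 e4
    have e5 : |(s + (t m - p m)) - (s + (t m' - p m'))| < d := by
      have : |(t m - p m) / d - (t m' - p m') / d| < 1 := by
        rw [abs_lt]; constructor <;> linarith
      rw [← sub_div, abs_div, abs_of_pos hd, div_lt_one hd] at this
      rwa [add_sub_add_left_eq_sub]
    have h3 := hu _ _ e5
    have h4 := hp m (s + (t m - p m))
    have h5 := hp m' (s + (t m' - p m'))
    rw [show s + (t m - p m) + p m = s + t m by ring] at h4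
    rw [show s + (t m' - p m') + p m' = s + t m' by ring] at h5
    rw [abs_lt] at *
    constructor <;> linarith [h3.1, h3.2, h4.1, h4.2, h5.1, h5.2]

lemma SeqAP.log_one_add {z : ℤ → ℝ} (hz : SeqAP z) {m : ℝ} (hm : 0 < m) (h : ∀ k, m ≤ 1 + z k) :
    SeqAP fun k => Real.log (1 + z k) := by
  have key : ∀ u v : ℝ, m ≤ u → m ≤ v → Real.log u - Real.log v ≤ |u - v| / m := by
    intro u v hu hv
    have hu0 := hm.trans_le hu
    have hv0 := hm.trans_le hv
    rw [← Real.log_div hu0.ne' hv0.ne']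
    refine (Real.log_le_sub_one_of_pos (div_pos hu0 hv0)).trans ?_
    rw [div_sub_one hv0.ne']
    calc (u - v) / v ≤ |u - v| / v := by gcongr; exact le_abs_self _
      _ ≤ |u - v| / m := by gcongr
  intro ε hε
  obtain ⟨l, hl⟩ := hz (ε * m) (by positivity)
  refine ⟨l, fun n => ?_⟩
  obtain ⟨q, hq, hq'⟩ := hl n
  refine ⟨q, fun k => ?_, hq'⟩
  have h1 := key _ _ (h (k + q)) (h k)
  have h2 := key _ _ (h k) (h (k + q))
  rw [abs_sub_comm] at h2
  have h3 : |(1 + z (k + q)) - (1 + z k)| / m < ε := by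
    rw [div_lt_iff₀ hm, add_sub_add_left_eq_sub]; exact hq k
  rw [abs_lt]
  constructor <;> linarith

/-- `w` together with the index shift `q` is a common `ε`-almost period of the instants, of two
functions and of two sequences. -/
structure CommonPeriod (t : ℤ → ℝ) (f g : ℝ → ℝ) (y z : ℤ → ℝ) (ε w : ℝ) (q : ℤ) : Prop where
  inst : ∀ k, |t (k + q) - t k - w| < ε
  fst : ∀ s, |f (s + w) - f s| < ε
  snd : ∀ s, |g (s + w) - g s| < ε
  seq_fst : ∀ k, |y (k + q) - y k| < ε
  seq_snd : ∀ k, |z (k + q) - z k| < ε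

/-- Two indices of the same colour see nearly the same data, so `t m - t m'` with index shift `m -
m'` is a common period. Fixing one representative `m'` per colour bounds `t m'`, and `t m` can be
found near any prescribed place. -/
lemma relDense_commonPeriod {t : ℤ → ℝ} {f g : ℝ → ℝ} {y z : ℤ → ℝ} (ht : UniformlyAP t)
    (hf : BohrAP f) (hg : BohrAP g) (hy : SeqAP y) (hz : SeqAP z) {d : ℝ} (hd0 : 0 ≤ d)
    (hd : ∀ u, ∃ k, u ≤ t k ∧ t k ≤ u + d) {ε : ℝ} (hε : 0 < ε) :
    RelDenseReal {w | ∃ q, CommonPeriod t f g y z ε w q} := by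
  obtain ⟨n, c, hc⟩ := (ht.finitelyColored.and ((hf.finitelyColored t).and
    ((hg.finitelyColored t).and (hy.finitelyColored.and hz.finitelyColored)))) ε hε
  have hrep : ∃ rep : Fin n → ℤ, ∀ m, c (rep (c m)) = c m := by
    classical
    refine ⟨fun i => if h : ∃ m, c m = i then h.choose else 0, fun m => ?_⟩
    have h : ∃ m', c m' = c m := ⟨m, rfl⟩
    simp only [h, dite_true]
    exact h.choose_spec
  obtain ⟨rep, hrep⟩ := hrep
  obtain ⟨R, hR⟩ := ((finite_range fun i => |t (rep i)|)).bddAbove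
  have hR' : ∀ i, |t (rep i)| ≤ R := fun i => hR ⟨i, rfl⟩
  have hR0 : 0 ≤ R := (abs_nonneg _).trans (hR' (c 0))
  refine ⟨2 * R + d + 1, by linarith, fun u => ?_⟩
  obtain ⟨m, hm1, hm2⟩ := hd (u + R)
  obtain ⟨h1, h2, h3, h4, h5⟩ := hc m (rep (c m)) (hrep m).symm
  set m' := rep (c m)
  have hb := abs_le.1 (hR' (c m))
  refine ⟨t m - t m', ⟨m - m', ⟨fun k => ?_, fun s => ?_, fun s => ?_, fun k => ?_, fun k => ?_⟩⟩,
    by linarith [hb.2], by linarith [hb.1]⟩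
  · have := h1 (k - m')
    rw [show m + (k - m') = k + (m - m') by ring, show m' + (k - m') = k by ring] at this
    rwa [show t (k + (m - m')) - t k - (t m - t m') = t (k + (m - m')) - t m - (t k - t m') by ring]
  · have := h2 (s - t m')
    rwa [show s - t m' + t m = s + (t m - t m') by ring, sub_add_cancel] at this
  · have := h3 (s - t m')
    rwa [show s - t m' + t m = s + (t m - t m') by ring, sub_add_cancel] at this
  · have := h4 (k - m')
    rwa [show k - m' + m = k + (m - m') by ring, sub_add_cancel] at this
  · have := h5 (k - m')
    rwa [show k - m' + m = k + (m - m') by ring, sub_add_cancel] at this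

/-! ### The linear impulsive equation and its propagator. -/

namespace HematopoiesisModel

/-- The standing assumptions on the data of the model. -/
structure Admissible (P : HematopoiesisModel) : Prop where
  τ_nonneg : 0 ≤ P.τ
  α_pos : 0 < P.α
  a_ap : BohrAP P.a
  aL_pos : 0 < P.aL
  b_ap : BohrAP P.b
  b_nonneg : ∀ s, 0 ≤ P.b s
  δ_ap : SeqAP P.δ
  γ_ap : SeqAP P.γ
  γL_gt : -1 < P.γL
  bddAbove : BddAbove P.gammaProducts
  ΓL_pos : 0 < P.ΓL
  t_ap : UniformlyAP P.t
  η_pos : 0 < P.η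

/-- Index of the first instant not before `s`. -/
def idx (P : HematopoiesisModel) (s : ℝ) : ℤ := sInf {k : ℤ | s ≤ P.t k}

/-- Discrete primitive of `log (1 + γ)`. -/
def lg (P : HematopoiesisModel) (k : ℤ) : ℝ :=
  ∑ i ∈ Finset.Ico 0 k, Real.log (1 + P.γ i) - ∑ i ∈ Finset.Ico k 0, Real.log (1 + P.γ i)

/-- Logarithm of a fundamental solution of the homogeneous linear impulsive equation. -/
def logFund (P : HematopoiesisModel) (s : ℝ) : ℝ := P.lg (P.idx s) - ∫ r in (0 : ℝ)..s, P.a r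

/-- Right limit of `logFund` at the instant `t k`. -/
def logFundRight (P : HematopoiesisModel) (k : ℤ) : ℝ :=
  P.lg (k + 1) - ∫ r in (0 : ℝ)..P.t k, P.a r

variable {P : HematopoiesisModel}

lemma lg_succ (k : ℤ) : P.lg (k + 1) = P.lg k + Real.log (1 + P.γ k) := by
  unfold lg
  rcases le_or_gt 0 k with hk | hk
  · have h0 : Finset.Ico 0 (k + 1) = insert k (Finset.Ico 0 k) := by ext; simp; omega
    have h1 : Finset.Ico (k + 1) 0 = ∅ := Finset.Ico_eq_empty (by omega)
    have h2 : Finset.Ico k 0 = ∅ := Finset.Ico_eq_empty (by omega)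
    rw [h0, h1, h2, Finset.sum_insert (by simp)]; simp [add_comm]
  · have h1 : Finset.Ico 0 (k + 1) = ∅ := Finset.Ico_eq_empty (by omega)
    have h2 : Finset.Ico 0 k = ∅ := Finset.Ico_eq_empty (by omega)
    have h3 : Finset.Ico k 0 = insert k (Finset.Ico (k + 1) 0) := by ext; simp; omega
    rw [h1, h2, h3, Finset.sum_insert (by simp)]; simp

lemma A_pos : 0 < P.A := one_pos.trans_le (le_max_right _ _)

namespace Admissible

variable (h : P.Admissible)
include h

lemma bdd_a : BddAbove (range P.a) ∧ BddBelow (range P.a) := by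
  obtain ⟨C, hC⟩ := h.a_ap.bounded
  exact ⟨⟨C, by rintro _ ⟨s, rfl⟩; exact (abs_le.1 (hC s)).2⟩,
    ⟨-C, by rintro _ ⟨s, rfl⟩; exact (abs_le.1 (hC s)).1⟩⟩

lemma aL_le (s : ℝ) : P.aL ≤ P.a s := ciInf_le h.bdd_a.2 s
lemma le_aM (s : ℝ) : P.a s ≤ P.aM := le_ciSup h.bdd_a.1 s
lemma aM_pos : 0 < P.aM := h.aL_pos.trans_le ((h.aL_le 0).trans (h.le_aM 0))

lemma bdd_b : BddAbove (range P.b) ∧ BddBelow (range P.b) := by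
  obtain ⟨C, hC⟩ := h.b_ap.bounded
  exact ⟨⟨C, by rintro _ ⟨s, rfl⟩; exact (abs_le.1 (hC s)).2⟩,
    ⟨-C, by rintro _ ⟨s, rfl⟩; exact (abs_le.1 (hC s)).1⟩⟩

lemma bL_le (s : ℝ) : P.bL ≤ P.b s := ciInf_le h.bdd_b.2 s
lemma le_bM (s : ℝ) : P.b s ≤ P.bM := le_ciSup h.bdd_b.1 s
lemma bL_nonneg : 0 ≤ P.bL := le_ciInf h.b_nonneg
lemma bM_nonneg : 0 ≤ P.bM := (h.b_nonneg 0).trans (h.le_bM 0)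

lemma bdd_δ : BddAbove (range P.δ) ∧ BddBelow (range P.δ) := by
  obtain ⟨C, hC⟩ := h.δ_ap.bounded
  exact ⟨⟨C, by rintro _ ⟨s, rfl⟩; exact (abs_le.1 (hC s)).2⟩,
    ⟨-C, by rintro _ ⟨s, rfl⟩; exact (abs_le.1 (hC s)).1⟩⟩

lemma δL_le (k : ℤ) : P.δL ≤ P.δ k := ciInf_le h.bdd_δ.2 k
lemma le_δM (k : ℤ) : P.δ k ≤ P.δM := le_ciSup h.bdd_δ.1 k

lemma γL_le (k : ℤ) : 1 + P.γL ≤ 1 + P.γ k := by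
  obtain ⟨C, hC⟩ := h.γ_ap.bounded
  have : BddBelow (range P.γ) := ⟨-C, by rintro _ ⟨s, rfl⟩; exact (abs_le.1 (hC s)).1⟩
  exact add_le_add_right (ciInf_le this k) 1

lemma one_add_γ_pos (k : ℤ) : 0 < 1 + P.γ k := by
  have := h.γL_le k; have := h.γL_gt; linarith

lemma bdd_gap : BddAbove (range fun k => P.t (k + 1) - P.t k) ∧
    BddBelow (range fun k => P.t (k + 1) - P.t k) := by
  obtain ⟨C, hC⟩ := h.t_ap.seqAP_gap.bounded
  exact ⟨⟨C, by rintro _ ⟨s, rfl⟩; exact (abs_le.1 (hC s)).2⟩,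
    ⟨-C, by rintro _ ⟨s, rfl⟩; exact (abs_le.1 (hC s)).1⟩⟩

lemma η_le (k : ℤ) : P.η ≤ P.t (k + 1) - P.t k := ciInf_le h.bdd_gap.2 k
lemma le_ηbar (k : ℤ) : P.t (k + 1) - P.t k ≤ P.ηbar := le_ciSup h.bdd_gap.1 k
lemma ηbar_pos : 0 < P.ηbar := h.η_pos.trans_le ((h.η_le 0).trans (h.le_ηbar 0))

lemma gap_ge {j k : ℤ} (hjk : j ≤ k) : ((k : ℝ) - j) * P.η ≤ P.t k - P.t j := by
  induction k, hjk using Int.leInduction with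
  | base => simp
  | succ k _ ih => have := h.η_le k; push_cast; linarith

lemma gap_le {j k : ℤ} (hjk : j ≤ k) : P.t k - P.t j ≤ ((k : ℝ) - j) * P.ηbar := by
  induction k, hjk using Int.leInduction with
  | base => simp
  | succ k _ ih => have := h.le_ηbar k; push_cast; linarith

lemma t_strictMono : StrictMono P.t :=
  strictMono_int_of_lt_succ fun k => by have := h.η_le k; have := h.η_pos; linarith

lemma t_unbounded (s : ℝ) : (∃ k, s ≤ P.t k) ∧ ∃ k, P.t k < s := by
  obtain ⟨n, hn⟩ := exists_nat_gt (|s - P.t 0| / P.η)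
  rw [div_lt_iff₀ h.η_pos] at hn
  have h1 := h.gap_ge (show (0 : ℤ) ≤ n by omega)
  have h2 := h.gap_ge (show (-n : ℤ) ≤ 0 by omega)
  push_cast at h1 h2
  have h3 := le_abs_self (s - P.t 0)
  have h4 := neg_abs_le (s - P.t 0)
  exact ⟨⟨n, by linarith⟩, ⟨-n, by linarith⟩⟩

lemma idx_spec (s : ℝ) : P.t (P.idx s - 1) < s ∧ s ≤ P.t (P.idx s) := by
  obtain ⟨⟨k, hk⟩, ⟨m, hm⟩⟩ := h.t_unbounded s
  have hb : BddBelow {k : ℤ | s ≤ P.t k} :=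
    ⟨m, fun j hj => (h.t_strictMono.lt_iff_lt.1 (hm.trans_le hj)).le⟩
  refine ⟨not_le.1 fun hc => ?_, Int.csInf_mem (s := {k : ℤ | s ≤ P.t k}) ⟨k, hk⟩ hb⟩
  have := csInf_le hb (show P.idx s - 1 ∈ {k : ℤ | s ≤ P.t k} from hc)
  unfold idx at this
  omega

lemma idx_eq {s : ℝ} {k : ℤ} (h1 : P.t (k - 1) < s) (h2 : s ≤ P.t k) : P.idx s = k := by
  obtain ⟨h3, h4⟩ := h.idx_spec s
  have h5 := h.t_strictMono.lt_iff_lt.1 (h1.trans_le h4)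
  have h6 := h.t_strictMono.lt_iff_lt.1 (h3.trans_le h2)
  omega

lemma idx_t (k : ℤ) : P.idx (P.t k) = k :=
  h.idx_eq (h.t_strictMono (by omega)) le_rfl

lemma idx_mono : Monotone P.idx := by
  intro s s' hs
  have h1 := (h.idx_spec s).1
  have h2 := (h.idx_spec s').2
  have := h.t_strictMono.lt_iff_lt.1 (h1.trans_le (hs.trans h2))
  omega

lemma exists_t_mem (u : ℝ) : ∃ k, u ≤ P.t k ∧ P.t k ≤ u + P.ηbar := by
  obtain ⟨h1, h2⟩ := h.idx_spec u
  refine ⟨P.idx u, h2, ?_⟩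
  have := h.le_ηbar (P.idx u - 1)
  rw [sub_add_cancel] at this
  linarith

lemma B_pos : 0 < P.B := lt_min h.ΓL_pos one_pos

lemma exp_lg_sub {j k : ℤ} (hjk : j ≤ k) :
    Real.exp (P.lg k - P.lg j) = ∏ i ∈ Finset.Ico j k, (1 + P.γ i) := by
  induction k, hjk using Int.leInduction with
  | base => simp
  | succ k hk ih =>
    have h0 : Finset.Ico j (k + 1) = insert k (Finset.Ico j k) := by ext; simp; omega
    rw [h0, Finset.prod_insert (by simp), ← ih, lg_succ, add_sub_right_comm, Real.exp_add,
      Real.exp_log (h.one_add_γ_pos k), mul_comm]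

lemma exp_lg_sub_mem {j k : ℤ} (hjk : j ≤ k) : Real.exp (P.lg k - P.lg j) ∈ Icc P.B P.A := by
  rcases hjk.eq_or_lt with rfl | hlt
  · rw [sub_self, Real.exp_zero]; exact ⟨min_le_right _ _, le_max_right _ _⟩
  · have hmem : Real.exp (P.lg k - P.lg j) ∈ P.gammaProducts := by
      refine ⟨j, k - 1, by omega, ?_⟩
      rw [h.exp_lg_sub hjk]
      congr 1
      ext; simp
    -- The infimum of a set of reals that is not bounded below is `0` by convention, which `ΓL > 0`
    -- excludes.
    have hbdd : BddBelow P.gammaProducts := by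
      by_contra hc
      have := h.ΓL_pos
      rw [ΓL, Real.sInf_of_not_bddBelow hc] at this
      exact this.false
    exact ⟨(min_le_left _ _).trans (csInf_le hbdd hmem),
      (le_csSup h.bddAbove hmem).trans (le_max_left _ _)⟩

lemma a_intervalIntegrable (s s' : ℝ) : IntervalIntegrable P.a MeasureTheory.volume s s' :=
  h.a_ap.1.intervalIntegrable _ _

lemma int_a_sub (s s' : ℝ) :
    (∫ r in (0 : ℝ)..s', P.a r) - ∫ r in (0 : ℝ)..s, P.a r = ∫ r in s..s', P.a r :=
  intervalIntegral.integral_interval_sub_left (h.a_intervalIntegrable _ _)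
    (h.a_intervalIntegrable _ _)

lemma le_int_a {s s' : ℝ} (hs : s ≤ s') : P.aL * (s' - s) ≤ ∫ r in s..s', P.a r := by
  have := intervalIntegral.integral_mono hs (intervalIntegrable_const (c := P.aL))
    (h.a_intervalIntegrable s s') h.aL_le
  rw [intervalIntegral.integral_const, smul_eq_mul] at this
  linarith

lemma int_a_le {s s' : ℝ} (hs : s ≤ s') : ∫ r in s..s', P.a r ≤ P.aM * (s' - s) := by
  have := intervalIntegral.integral_mono hs (h.a_intervalIntegrable s s')
    (intervalIntegrable_const (c := P.aM)) h.le_aM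
  rw [intervalIntegral.integral_const, smul_eq_mul] at this
  linarith

/-- Separating the lattice index from the time covers both `logFund` and its right limits
`logFundRight`, which differ only in the index used in `lg`. -/
lemma exp_mem_aux {j k : ℤ} (hjk : j ≤ k) {s s' : ℝ} (hs : s ≤ s') :
    P.B * Real.exp (-P.aM * (s' - s)) ≤
        Real.exp ((P.lg k - ∫ r in (0 : ℝ)..s', P.a r) - (P.lg j - ∫ r in (0 : ℝ)..s, P.a r)) ∧
      Real.exp ((P.lg k - ∫ r in (0 : ℝ)..s', P.a r) - (P.lg j - ∫ r in (0 : ℝ)..s, P.a r)) ≤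
        P.A * Real.exp (-P.aL * (s' - s)) := by
  have h1 := h.exp_lg_sub_mem hjk
  have h2 := h.le_int_a hs
  have h3 := h.int_a_le hs
  rw [← h.int_a_sub] at h2 h3
  rw [sub_sub_sub_comm, sub_eq_add_neg (P.lg k - P.lg j), Real.exp_add]
  have := A_pos (P := P)
  constructor
  · exact mul_le_mul h1.1 (Real.exp_le_exp.2 (by linarith)) (Real.exp_pos _).le (Real.exp_pos _).le
  · exact mul_le_mul h1.2 (Real.exp_le_exp.2 (by linarith)) (Real.exp_pos _).le this.le

lemma weight_le {s s' : ℝ} (hs : s ≤ s') :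
    Real.exp (P.logFund s' - P.logFund s) ≤ P.A * Real.exp (-P.aL * (s' - s)) :=
  (h.exp_mem_aux (h.idx_mono hs) hs).2

lemma le_weight {s s' : ℝ} (hs : s ≤ s') :
    P.B * Real.exp (-P.aM * (s' - s)) ≤ Real.exp (P.logFund s' - P.logFund s) :=
  (h.exp_mem_aux (h.idx_mono hs) hs).1

lemma weightRight_le {s : ℝ} {k : ℤ} (hk : P.t k < s) :
    Real.exp (P.logFund s - P.logFundRight k) ≤ P.A * Real.exp (-P.aL * (s - P.t k)) := by
  refine (h.exp_mem_aux ?_ hk.le).2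
  have := h.t_strictMono.lt_iff_lt.1 (hk.trans_le (h.idx_spec s).2)
  omega

lemma le_weightRight {s : ℝ} {k : ℤ} (hk : P.t k < s) :
    P.B * Real.exp (-P.aM * (s - P.t k)) ≤ Real.exp (P.logFund s - P.logFundRight k) := by
  refine (h.exp_mem_aux ?_ hk.le).1
  have := h.t_strictMono.lt_iff_lt.1 (hk.trans_le (h.idx_spec s).2)
  omega

lemma idx_sub_spec (s : ℝ) (j : ℕ) : P.t (P.idx s - 1 - j) < s ∧ j * P.η ≤ s - P.t (P.idx s - 1 - j) ∧
    s - P.t (P.idx s - 1 - j) ≤ (j + 1) * P.ηbar := by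
  obtain ⟨h1, h2⟩ := h.idx_spec s
  have h3 := h.gap_ge (show P.idx s - 1 - j ≤ P.idx s - 1 by omega)
  have h4 := h.gap_le (show P.idx s - 1 - j ≤ P.idx s by omega)
  push_cast at h3 h4
  have : 0 ≤ (j : ℝ) * P.η := mul_nonneg (Nat.cast_nonneg _) h.η_pos.le
  exact ⟨by linarith, by linarith, by linarith⟩

end Admissible

/-! ### The response to the jumps. -/

/-- Bounded response of the linear impulsive equation to the jumps `δ`. -/
def jumpResponse (P : HematopoiesisModel) (s : ℝ) : ℝ :=
  ∑' j : ℕ, Real.exp (P.logFund s - P.logFundRight (P.idx s - 1 - j)) * P.δ (P.idx s - 1 - j)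

/-- Amplitude of `jumpResponse` on `(t (k - 1), t k]`. -/
def jumpCoeff (P : HematopoiesisModel) (k : ℤ) : ℝ :=
  ∑' j : ℕ, Real.exp (-P.logFundRight (k - 1 - j)) * P.δ (k - 1 - j)

/-- Upper bound of `jumpResponse`. -/
def jumpUpper (P : HematopoiesisModel) : ℝ :=
  P.A * max P.δM 0 / (1 - Real.exp (-P.aL * P.η))

open Classical in
/-- Lower bound of `jumpResponse`. -/
def jumpLower (P : HematopoiesisModel) : ℝ :=
  if 0 ≤ P.δL then
    P.B * P.δL * Real.exp (-P.aM * P.ηbar) / (1 - Real.exp (-P.aM * P.ηbar))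
  else P.A * P.δL / (1 - Real.exp (-P.aL * P.η))

lemma jumpResponse_eq (s : ℝ) :
    P.jumpResponse s = Real.exp (P.logFund s) * P.jumpCoeff (P.idx s) := by
  unfold jumpResponse jumpCoeff
  rw [← tsum_mul_left]
  congr 1
  ext j
  rw [sub_eq_add_neg, Real.exp_add, mul_assoc]

namespace Admissible

variable (h : P.Admissible)
include h

lemma ratio_lt_one : Real.exp (-P.aL * P.η) < 1 :=
  by
  have := mul_pos h.aL_pos h.η_pos
  rw [Real.exp_lt_one_iff]
  linarith

lemma ratio_bar_lt_one : Real.exp (-P.aM * P.ηbar) < 1 :=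
  by
  have := mul_pos h.aM_pos h.ηbar_pos
  rw [Real.exp_lt_one_iff]
  linarith

lemma weightRight_idx_le (s : ℝ) (j : ℕ) :
    Real.exp (P.logFund s - P.logFundRight (P.idx s - 1 - j)) ≤
      P.A * Real.exp (-P.aL * P.η) ^ j := by
  obtain ⟨h1, h2, h3⟩ := h.idx_sub_spec s j
  refine (h.weightRight_le h1).trans ?_
  rw [← Real.exp_nat_mul]
  have := mul_le_mul_of_nonneg_left h2 h.aL_pos.le
  exact mul_le_mul_of_nonneg_left (Real.exp_le_exp.2 (by linarith)) A_pos.le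

/-- The instant numbered `j` before `s` is at most `(j + 1) * ηbar` away. The exponent `j + 1`,
against `j` in the upper estimate, produces the extra factor `e^{-aM ηbar}` in the numerator of
`M₂`. -/
lemma le_weightRight_idx (s : ℝ) (j : ℕ) :
    P.B * Real.exp (-P.aM * P.ηbar) ^ (j + 1) ≤
      Real.exp (P.logFund s - P.logFundRight (P.idx s - 1 - j)) := by
  obtain ⟨h1, h2, h3⟩ := h.idx_sub_spec s j
  refine le_trans ?_ (h.le_weightRight h1)
  rw [← Real.exp_nat_mul]
  have := mul_le_mul_of_nonneg_left h3 h.aM_pos.le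
  exact mul_le_mul_of_nonneg_left (Real.exp_le_exp.2 (by push_cast; linarith)) h.B_pos.le

lemma exists_δ_bound : ∃ C, 0 ≤ C ∧ ∀ k, |P.δ k| ≤ C := by
  obtain ⟨C, hC⟩ := h.δ_ap.bounded
  exact ⟨C, (abs_nonneg _).trans (hC 0), hC⟩

lemma summable_geom : Summable fun j : ℕ => Real.exp (-P.aL * P.η) ^ j :=
  summable_geometric_of_lt_one (Real.exp_pos _).le h.ratio_lt_one

lemma summable_jumpResponse (s : ℝ) : Summable fun j : ℕ =>
    Real.exp (P.logFund s - P.logFundRight (P.idx s - 1 - j)) * P.δ (P.idx s - 1 - j) := by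
  obtain ⟨C, hC0, hC⟩ := h.exists_δ_bound
  refine Summable.of_norm_bounded (h.summable_geom.mul_left (P.A * C)) fun j => ?_
  rw [Real.norm_eq_abs, abs_mul, abs_of_pos (Real.exp_pos _)]
  calc _ ≤ (P.A * Real.exp (-P.aL * P.η) ^ j) * C :=
        mul_le_mul (h.weightRight_idx_le s j) (hC _) (abs_nonneg _)
          (mul_nonneg A_pos.le (pow_nonneg (Real.exp_pos _).le _))
    _ = _ := by ring

lemma jumpUpper_nonneg : 0 ≤ P.jumpUpper :=
  div_nonneg (mul_nonneg A_pos.le (le_max_right _ _)) (by linarith [h.ratio_lt_one])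

lemma jumpResponse_le (s : ℝ) : P.jumpResponse s ≤ P.jumpUpper := by
  have hg : HasSum (fun j : ℕ => P.A * max P.δM 0 * Real.exp (-P.aL * P.η) ^ j) P.jumpUpper :=
    (hasSum_geometric_of_lt_one (Real.exp_pos _).le h.ratio_lt_one).mul_left _
  refine hasSum_le (fun j => ?_) (h.summable_jumpResponse s).hasSum hg
  calc _ ≤ Real.exp (P.logFund s - P.logFundRight (P.idx s - 1 - j)) * max P.δM 0 :=
        mul_le_mul_of_nonneg_left ((h.le_δM _).trans (le_max_left _ _)) (Real.exp_pos _).le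
    _ ≤ (P.A * Real.exp (-P.aL * P.η) ^ j) * max P.δM 0 :=
        mul_le_mul_of_nonneg_right (h.weightRight_idx_le s j) (le_max_right _ _)
    _ = _ := by ring

lemma jumpLower_le (s : ℝ) : P.jumpLower ≤ P.jumpResponse s := by
  unfold jumpLower
  -- The sign of `δL` decides whether the lower or the upper bound of the weights gives a lower
  -- bound of the sum.
  split_ifs with h0
  · have hg : HasSum (fun j : ℕ => P.B * P.δL * Real.exp (-P.aM * P.ηbar) *
        Real.exp (-P.aM * P.ηbar) ^ j) _ :=
      (hasSum_geometric_of_lt_one (Real.exp_pos _).le h.ratio_bar_lt_one).mul_left _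
    refine hasSum_le (fun j => ?_) hg (h.summable_jumpResponse s).hasSum
    calc _ = (P.B * Real.exp (-P.aM * P.ηbar) ^ (j + 1)) * P.δL := by ring
      _ ≤ Real.exp (P.logFund s - P.logFundRight (P.idx s - 1 - j)) * P.δL :=
        mul_le_mul_of_nonneg_right (h.le_weightRight_idx s j) h0
      _ ≤ _ := mul_le_mul_of_nonneg_left (h.δL_le _) (Real.exp_pos _).le
  · have hg : HasSum (fun j : ℕ => P.A * P.δL * Real.exp (-P.aL * P.η) ^ j) _ :=
      (hasSum_geometric_of_lt_one (Real.exp_pos _).le h.ratio_lt_one).mul_left _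
    refine hasSum_le (fun j => ?_) hg (h.summable_jumpResponse s).hasSum
    calc _ = (P.A * Real.exp (-P.aL * P.η) ^ j) * P.δL := by ring
      _ ≤ Real.exp (P.logFund s - P.logFundRight (P.idx s - 1 - j)) * P.δL :=
        mul_le_mul_of_nonpos_right (h.weightRight_idx_le s j) (not_le.1 h0).le
      _ ≤ _ := mul_le_mul_of_nonneg_left (h.δL_le _) (Real.exp_pos _).le

lemma exists_jumpResponse_bound : ∃ S, 0 ≤ S ∧ ∀ s, |P.jumpResponse s| ≤ S :=
  ⟨max |P.jumpLower| |P.jumpUpper|, le_max_of_le_left (abs_nonneg _), fun s =>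
    abs_le_max_abs_abs (h.jumpLower_le s) (h.jumpResponse_le s)⟩

/-- Passing `t k` adds exactly one term to the series; this is how the inhomogeneous part `δ k` of
the jump condition enters. -/
lemma jumpCoeff_succ (k : ℤ) :
    P.jumpCoeff (k + 1) = Real.exp (-P.logFundRight k) * P.δ k + P.jumpCoeff k := by
  have hs := h.summable_jumpResponse (P.t (k + 1))
  rw [h.idx_t] at hs
  have hs' : Summable fun j : ℕ =>
      Real.exp (-P.logFundRight (k + 1 - 1 - j)) * P.δ (k + 1 - 1 - j) := by
    refine (hs.mul_left (Real.exp (-P.logFund (P.t (k + 1))))).congr fun j => ?_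
    rw [← mul_assoc, ← Real.exp_add]
    congr 2
    ring
  unfold jumpCoeff
  rw [hs'.tsum_eq_zero_add]
  congr 1
  · simp
  · congr 1
    ext j
    rw [show k + 1 - 1 - ((j + 1 : ℕ) : ℤ) = k - 1 - j by push_cast; ring]

end Admissible

lemma M₁_eq : P.M₁ = P.A / P.aL * P.bM + P.jumpUpper := rfl

lemma M₂_eq : P.M₂ = P.B / P.aM * (P.bL / (1 + P.M₁ ^ P.α)) + P.jumpLower := rfl

end HematopoiesisModel

/-! ### The Hill function and the integral operator. -/

open MeasureTheory in
lemma integrableOn_exp_neg_mul_sub {c : ℝ} (hc : 0 < c) (s : ℝ) :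
    IntegrableOn (fun r : ℝ => Real.exp (-c * (s - r))) (Iic s) := by
  refine ((integrableOn_exp_mul_Iic hc s).const_mul (Real.exp (-c * s))).congr
    (ae_of_all _ fun r => ?_)
  simp only
  rw [← Real.exp_add]
  congr 1
  ring

lemma integral_exp_neg_mul_sub {c : ℝ} (hc : 0 < c) (s : ℝ) :
    ∫ r in Iic s, Real.exp (-c * (s - r)) = 1 / c := by
  have : ∀ r : ℝ, Real.exp (-c * (s - r)) = Real.exp (-c * s) * Real.exp (c * r) := fun r => by
    rw [← Real.exp_add]; congr 1; ring
  simp_rw [this]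
  rw [MeasureTheory.integral_const_mul, integral_exp_mul_Iic hc, mul_div_assoc', ← Real.exp_add]
  simp

namespace HematopoiesisModel

variable {P : HematopoiesisModel}

/-- The production term of the model along `x`. -/
def feed (P : HematopoiesisModel) (x : ℝ → ℝ) (s : ℝ) : ℝ :=
  P.b s / (1 + x (s - P.τ) ^ P.α)

/-- The Hill function. -/
def hill (P : HematopoiesisModel) (v : ℝ) : ℝ := 1 / (1 + v ^ P.α)

/-- The integral operator whose fixed points are the bounded solutions. -/
def op (P : HematopoiesisModel) (x : ℝ → ℝ) (s : ℝ) : ℝ :=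
  (∫ r in Iic s, Real.exp (P.logFund s - P.logFund r) * P.feed x r) + P.jumpResponse s

/-- A Lipschitz constant of the Hill function on `[m, M]`. -/
def lip (P : HematopoiesisModel) (m M : ℝ) : ℝ := P.α * max (m ^ (P.α - 1)) (M ^ (P.α - 1))

lemma feed_eq (x : ℝ → ℝ) (s : ℝ) : P.feed x s = P.b s * P.hill (x (s - P.τ)) :=
  div_eq_mul_one_div _ _

lemma rhs_eq (x : ℝ → ℝ) (s : ℝ) : P.rhs x s = -P.a s * x s + P.feed x s := rfl

lemma one_le_one_add_rpow {v : ℝ} (hv : 0 ≤ v) : 1 ≤ 1 + v ^ P.α :=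
  le_add_of_nonneg_right (Real.rpow_nonneg hv _)

lemma hill_pos {v : ℝ} (hv : 0 ≤ v) : 0 < P.hill v :=
  one_div_pos.2 (one_pos.trans_le (one_le_one_add_rpow hv))

lemma hill_le_one {v : ℝ} (hv : 0 ≤ v) : P.hill v ≤ 1 :=
  div_le_one_of_le₀ (one_le_one_add_rpow hv) (one_pos.le.trans (one_le_one_add_rpow hv))

lemma abs_hill_sub_le_one {u v : ℝ} (hu : 0 ≤ u) (hv : 0 ≤ v) : |P.hill u - P.hill v| ≤ 1 := by
  have h1 := hill_pos (P := P) hu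
  have h2 := hill_pos (P := P) hv
  have h3 := hill_le_one (P := P) hu
  have h4 := hill_le_one (P := P) hv
  rw [abs_le]
  constructor <;> linarith

lemma hasDerivAt_hill {v : ℝ} (hv : 0 < v) :
    HasDerivAt P.hill (-(P.α * v ^ (P.α - 1)) / (1 + v ^ P.α) ^ 2) v := by
  have h1 : HasDerivAt (fun v : ℝ => 1 + v ^ P.α) (P.α * v ^ (P.α - 1)) v :=
    (Real.hasDerivAt_rpow_const (Or.inl hv.ne')).const_add 1
  have h2 := h1.fun_inv (one_pos.trans_le (one_le_one_add_rpow hv.le)).ne'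
  have h3 : P.hill = fun v : ℝ => (1 + v ^ P.α)⁻¹ := funext fun v => one_div _
  rw [h3]
  exact h2

lemma rpow_sub_one_le_max {m M v : ℝ} (hm : 0 < m) (hv : v ∈ Icc m M) (p : ℝ) :
    v ^ p ≤ max (m ^ p) (M ^ p) := by
  rcases le_total 0 p with hp | hp
  · exact le_max_of_le_right (Real.rpow_le_rpow (hm.le.trans hv.1) hv.2 hp)
  · exact le_max_of_le_left (Real.rpow_le_rpow_of_nonpos hm hv.1 hp)

lemma measurable_hill : Measurable P.hill := by
  unfold hill
  fun_prop

namespace Admissible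

variable (h : P.Admissible)
include h

lemma hill_antitone {u v : ℝ} (hu : 0 ≤ u) (huv : u ≤ v) : P.hill v ≤ P.hill u :=
  one_div_le_one_div_of_le (one_pos.trans_le (one_le_one_add_rpow hu))
    (add_le_add_right (Real.rpow_le_rpow hu huv h.α_pos.le) 1)

lemma continuousAt_hill {v : ℝ} (hv : 0 ≤ v) : ContinuousAt P.hill v := by
  have := (Real.continuous_rpow_const h.α_pos.le (q := P.α)).continuousAt (x := v)
  exact continuousAt_const.div (continuousAt_const.add this)
    (one_pos.trans_le (one_le_one_add_rpow hv)).ne'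

lemma lip_nonneg {m M : ℝ} (hm : 0 < m) : 0 ≤ P.lip m M :=
  mul_nonneg h.α_pos.le (le_max_of_le_left (Real.rpow_nonneg hm.le _))

/-- The derivative has modulus `α v ^ (α - 1) / (1 + v ^ α) ^ 2`, where the denominator is at least
`1`; the power in the numerator is monotone in one direction or the other, so an endpoint maximizes
it. -/
lemma hill_lip {m M u v : ℝ} (hm : 0 < m) (hu : u ∈ Icc m M) (hv : v ∈ Icc m M) :
    |P.hill u - P.hill v| ≤ P.lip m M * |u - v| := by
  have key := (convex_Icc m M).norm_image_sub_le_of_norm_hasDerivWithin_le (f := P.hill)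
    (C := P.lip m M) (fun w hw => (hasDerivAt_hill (P := P) (hm.trans_le hw.1)).hasDerivWithinAt)
    (fun w hw => ?_) hv hu
  · exact key
  · have hw0 := hm.trans_le hw.1
    have h1 := one_le_one_add_rpow (P := P) hw0.le
    have h2 : 0 ≤ P.α * w ^ (P.α - 1) := mul_nonneg h.α_pos.le (Real.rpow_nonneg hw0.le _)
    rw [norm_div, norm_neg, Real.norm_of_nonneg h2, Real.norm_of_nonneg (by positivity)]
    refine (div_le_self h2 (one_le_pow₀ h1)).trans ?_
    exact mul_le_mul_of_nonneg_left (rpow_sub_one_le_max hm hw _) h.α_pos.le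

/-- For `α < 1` the Hill function is not Lipschitz at `0`, but it suffices that one argument stays
above `m`. If the other is at least `m / 2`, the derivative is at most `α / (m / 2)` in modulus;
otherwise the arguments are at least `m / 2` apart while the values differ by at most `1`. -/
lemma exists_hill_lip_global {m : ℝ} (hm : 0 < m) :
    ∃ L, 0 ≤ L ∧ ∀ u v, 0 ≤ u → m ≤ v → |P.hill u - P.hill v| ≤ L * |u - v| := by
  have hα := h.α_pos
  refine ⟨max (P.α / (m / 2)) (2 / m), le_max_of_le_right (by positivity), fun u v hu hv => ?_⟩
  rcases le_total (m / 2) u with hmu | hmu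
  · have key := (convex_Ici (m / 2)).norm_image_sub_le_of_norm_hasDerivWithin_le (f := P.hill)
      (C := P.α / (m / 2))
      (fun w hw => (hasDerivAt_hill (P := P) ((half_pos hm).trans_le hw)).hasDerivWithinAt)
      (fun w hw => ?_) (show v ∈ Ici (m / 2) by simp; linarith) (show u ∈ Ici (m / 2) from hmu)
    · exact key.trans (mul_le_mul_of_nonneg_right (le_max_left _ _) (abs_nonneg _))
    · have hw0 : 0 < w := (half_pos hm).trans_le hw
      have hp : 0 < w ^ P.α := Real.rpow_pos_of_pos hw0 _
      rw [norm_div, norm_neg, Real.norm_of_nonneg (by positivity),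
        Real.norm_of_nonneg (by positivity), Real.rpow_sub_one hw0.ne']
      calc P.α * (w ^ P.α / w) / (1 + w ^ P.α) ^ 2 ≤ P.α * (w ^ P.α / w) / w ^ P.α := by
            gcongr
            nlinarith
        _ = P.α / w := by field_simp
        _ ≤ P.α / (m / 2) := by gcongr; exact hw
  · refine (abs_hill_sub_le_one hu (hm.le.trans hv)).trans ?_
    have h1 : m / 2 ≤ |u - v| := by
      rw [abs_sub_comm]; exact le_trans (by linarith) (le_abs_self _)
    calc (1 : ℝ) = 2 / m * (m / 2) := by field_simp
      _ ≤ max (P.α / (m / 2)) (2 / m) * |u - v| := by gcongr; exact le_max_right _ _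

lemma feed_nonneg {x : ℝ → ℝ} {s : ℝ} (hx : 0 ≤ x (s - P.τ)) : 0 ≤ P.feed x s := by
  rw [feed_eq]
  exact mul_nonneg (h.b_nonneg s) (hill_pos hx).le

lemma feed_le {x : ℝ → ℝ} {s : ℝ} (hx : 0 ≤ x (s - P.τ)) : P.feed x s ≤ P.bM := by
  rw [feed_eq]
  exact (mul_le_of_le_one_right (h.b_nonneg s) (hill_le_one hx)).trans (h.le_bM s)

lemma le_feed {x : ℝ → ℝ} {s U : ℝ} (hx : 0 ≤ x (s - P.τ)) (hU : x (s - P.τ) ≤ U) :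
    P.bL / (1 + U ^ P.α) ≤ P.feed x s := by
  rw [feed_eq, div_eq_mul_one_div]
  exact mul_le_mul (h.bL_le s) (h.hill_antitone hx hU) (hill_pos (hx.trans hU)).le (h.b_nonneg s)

lemma measurable_feed {x : ℝ → ℝ} (hx : Measurable x) : Measurable (P.feed x) := by
  have : P.feed x = fun s => P.b s * P.hill (x (s - P.τ)) := funext fun s => feed_eq x s
  rw [this]
  exact h.b_ap.1.measurable.mul (measurable_hill.comp (hx.comp (measurable_id.sub_const _)))

lemma continuous_int_a : Continuous fun s => ∫ r in (0 : ℝ)..s, P.a r :=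
  intervalIntegral.continuous_primitive h.a_intervalIntegrable 0

lemma measurable_logFund : Measurable P.logFund := by
  have h1 : Measurable P.lg := Measurable.of_discrete
  exact (h1.comp h.idx_mono.measurable).sub h.continuous_int_a.measurable

open MeasureTheory in
lemma integrableOn_weight_mul {g : ℝ → ℝ} (hg : Measurable g) {C : ℝ} (hC : ∀ r, |g r| ≤ C)
    (s : ℝ) :
    IntegrableOn (fun r => Real.exp (P.logFund s - P.logFund r) * g r) (Iic s) := by
  refine Integrable.mono' (((integrableOn_exp_neg_mul_sub h.aL_pos s).const_mul P.A).mul_const C)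
    ?_ ?_
  · exact ((Real.measurable_exp.comp (h.measurable_logFund.const_sub _)).mul
      hg).aestronglyMeasurable
  · refine (ae_restrict_iff' measurableSet_Iic).2 (ae_of_all _ fun r hr => ?_)
    rw [norm_mul, Real.norm_of_nonneg (Real.exp_pos _).le]
    exact mul_le_mul (h.weight_le hr) (hC r) (norm_nonneg _)
      (mul_nonneg A_pos.le (Real.exp_pos _).le)

lemma abs_feed_le {x : ℝ → ℝ} {s : ℝ} (hx : 0 ≤ x (s - P.τ)) : |P.feed x s| ≤ P.bM := by
  rw [abs_of_nonneg (h.feed_nonneg hx)]; exact h.feed_le hx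

lemma integrableOn_weight_feed {x : ℝ → ℝ} (hx : Measurable x) (h0 : ∀ s, 0 ≤ x s) (s : ℝ) :
    MeasureTheory.IntegrableOn (fun r => Real.exp (P.logFund s - P.logFund r) * P.feed x r)
      (Iic s) :=
  h.integrableOn_weight_mul (h.measurable_feed hx) (fun _ => h.abs_feed_le (h0 _)) s

lemma op_le {x : ℝ → ℝ} (hx : Measurable x) (h0 : ∀ s, 0 ≤ x s) (s : ℝ) : P.op x s ≤ P.M₁ := by
  rw [M₁_eq]
  refine add_le_add ?_ (h.jumpResponse_le s)
  have h1 : ∫ r in Iic s, P.A * Real.exp (-P.aL * (s - r)) * P.bM = P.A / P.aL * P.bM := by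
    rw [MeasureTheory.integral_mul_const, MeasureTheory.integral_const_mul,
      integral_exp_neg_mul_sub h.aL_pos]
    ring
  rw [← h1]
  refine MeasureTheory.setIntegral_mono_on (h.integrableOn_weight_feed hx h0 s)
    (((integrableOn_exp_neg_mul_sub h.aL_pos s).const_mul P.A).mul_const _) measurableSet_Iic
    fun r hr => ?_
  exact mul_le_mul (h.weight_le hr) (h.feed_le (h0 _)) (h.feed_nonneg (h0 _))
    (mul_nonneg A_pos.le (Real.exp_pos _).le)

lemma M₁_nonneg : 0 ≤ P.M₁ := by
  rw [M₁_eq]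
  have := h.jumpUpper_nonneg
  have := h.bM_nonneg
  have := h.aL_pos
  have := A_pos (P := P)
  positivity

lemma le_op {x : ℝ → ℝ} (hx : Measurable x) (h0 : ∀ s, 0 ≤ x s) (h1 : ∀ s, x s ≤ P.M₁) (s : ℝ) :
    P.M₂ ≤ P.op x s := by
  rw [M₂_eq]
  refine add_le_add ?_ (h.jumpLower_le s)
  set K := P.bL / (1 + P.M₁ ^ P.α)
  have hK : 0 ≤ K := div_nonneg h.bL_nonneg
    (one_pos.le.trans (one_le_one_add_rpow h.M₁_nonneg))
  have h2 : ∫ r in Iic s, P.B * Real.exp (-P.aM * (s - r)) * K = P.B / P.aM * K := by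
    rw [MeasureTheory.integral_mul_const, MeasureTheory.integral_const_mul,
      integral_exp_neg_mul_sub h.aM_pos]
    ring
  rw [← h2]
  refine MeasureTheory.setIntegral_mono_on
    (((integrableOn_exp_neg_mul_sub h.aM_pos s).const_mul P.B).mul_const _)
    (h.integrableOn_weight_feed hx h0 s) measurableSet_Iic fun r hr => ?_
  exact mul_le_mul (h.le_weight hr) (h.le_feed (h0 _) (h1 _)) hK (Real.exp_pos _).le

lemma abs_op_sub_le {x y : ℝ → ℝ} (hx : Measurable x) (hx0 : ∀ s, 0 ≤ x s) (hy : Measurable y)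
    (hy0 : ∀ s, 0 ≤ y s) {D : ℝ} (hD : ∀ s, |P.hill (x s) - P.hill (y s)| ≤ D) (s : ℝ) :
    |P.op x s - P.op y s| ≤ P.A / P.aL * P.bM * D := by
  have h1 : ∫ r in Iic s, P.A * Real.exp (-P.aL * (s - r)) * (P.bM * D)
      = P.A / P.aL * P.bM * D := by
    rw [MeasureTheory.integral_mul_const, MeasureTheory.integral_const_mul,
      integral_exp_neg_mul_sub h.aL_pos]
    ring
  unfold op
  rw [add_sub_add_right_eq_sub, ← MeasureTheory.integral_sub (h.integrableOn_weight_feed hx hx0 s)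
    (h.integrableOn_weight_feed hy hy0 s), ← h1, ← Real.norm_eq_abs]
  refine MeasureTheory.norm_integral_le_of_norm_le
    (((integrableOn_exp_neg_mul_sub h.aL_pos s).const_mul P.A).mul_const _)
    ((MeasureTheory.ae_restrict_iff' measurableSet_Iic).2
      (MeasureTheory.ae_of_all _ fun r hr => ?_))
  rw [← mul_sub, norm_mul, Real.norm_of_nonneg (Real.exp_pos _).le, feed_eq, feed_eq, ← mul_sub,
    norm_mul, Real.norm_of_nonneg (h.b_nonneg r)]
  exact mul_le_mul (h.weight_le hr)
    (mul_le_mul (h.le_bM r) (hD _) (norm_nonneg _) h.bM_nonneg)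
    (mul_nonneg (h.b_nonneg r) (norm_nonneg _)) (mul_nonneg A_pos.le (Real.exp_pos _).le)

end Admissible
end HematopoiesisModel

/-! ### The fixed point and the differential equation. -/

namespace HematopoiesisModel

variable {P : HematopoiesisModel}

lemma logFund_eq_of_idx {r : ℝ} {k : ℤ} (hr : P.idx r = k) :
    P.logFund r = P.lg k - ∫ u in (0 : ℝ)..r, P.a u := by
  rw [logFund, hr]

/-- The integral part of `op`, divided by the fundamental solution. -/
def accum (P : HematopoiesisModel) (x : ℝ → ℝ) (s : ℝ) : ℝ :=
  ∫ r in Iic s, Real.exp (-P.logFund r) * P.feed x r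

lemma op_eq (x : ℝ → ℝ) (s : ℝ) :
    P.op x s = Real.exp (P.logFund s) * (P.accum x s + P.jumpCoeff (P.idx s)) := by
  unfold op accum
  rw [jumpResponse_eq, mul_add, ← MeasureTheory.integral_const_mul]
  simp_rw [sub_eq_add_neg, Real.exp_add, mul_assoc]

namespace Admissible

variable (h : P.Admissible)
include h

lemma integrableOn_accum {x : ℝ → ℝ} (hx : Measurable x) (h0 : ∀ s, 0 ≤ x s) (s : ℝ) :
    MeasureTheory.IntegrableOn (fun r => Real.exp (-P.logFund r) * P.feed x r) (Iic s) := by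
  refine ((h.integrableOn_weight_feed hx h0 s).const_mul (Real.exp (-P.logFund s))).congr
    (MeasureTheory.ae_of_all _ fun r => ?_)
  simp only
  rw [← mul_assoc, ← Real.exp_add]
  congr 2
  ring

lemma intervalIntegrable_accum {x : ℝ → ℝ} (hx : Measurable x) (h0 : ∀ s, 0 ≤ x s) (u v : ℝ) :
    IntervalIntegrable (fun r => Real.exp (-P.logFund r) * P.feed x r) MeasureTheory.volume u v :=
  ⟨(h.integrableOn_accum hx h0 v).mono_set Ioc_subset_Iic_self,
    (h.integrableOn_accum hx h0 u).mono_set Ioc_subset_Iic_self⟩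

lemma accum_eq {x : ℝ → ℝ} (hx : Measurable x) (h0 : ∀ s, 0 ≤ x s) : P.accum x = fun s =>
    (∫ r in (0 : ℝ)..s, Real.exp (-P.logFund r) * P.feed x r) + P.accum x 0 := by
  ext s
  unfold accum
  rw [← intervalIntegral.integral_Iic_sub_Iic (h.integrableOn_accum hx h0 0)
    (h.integrableOn_accum hx h0 s), sub_add_cancel]

lemma continuous_accum {x : ℝ → ℝ} (hx : Measurable x) (h0 : ∀ s, 0 ≤ x s) :
    Continuous (P.accum x) := by
  rw [h.accum_eq hx h0]
  exact (intervalIntegral.continuous_primitive (h.intervalIntegrable_accum hx h0) 0).add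
    continuous_const

lemma measurable_op {x : ℝ → ℝ} (hx : Measurable x) (h0 : ∀ s, 0 ≤ x s) :
    Measurable (P.op x) := by
  rw [funext (op_eq x)]
  have hc : Measurable P.jumpCoeff := Measurable.of_discrete
  exact (Real.measurable_exp.comp h.measurable_logFund).mul
    ((h.continuous_accum hx h0).measurable.add (hc.comp h.idx_mono.measurable))

/-- Both constants bound the image under `op` of the constant function `M₁`. -/
lemma M₂_le_M₁ : P.M₂ ≤ P.M₁ :=
  (h.le_op measurable_const (fun _ => h.M₁_nonneg) (fun _ => le_rfl) 0).trans
    (h.op_le measurable_const (fun _ => h.M₁_nonneg) 0)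

/-- Picard iteration from the constant `M₁`, carried out pointwise with a uniform geometric rate;
measurability, which `op` needs, passes to the pointwise limit. -/
lemma exists_fixed_point (hM₂ : 0 < P.M₂) {K : ℝ} (hK0 : 0 ≤ K)
    (hK : ∀ u ∈ Icc P.M₂ P.M₁, ∀ v ∈ Icc P.M₂ P.M₁, |P.hill u - P.hill v| ≤ K * |u - v|)
    (hθ : P.A / P.aL * P.bM * K < 1) :
    ∃ x : ℝ → ℝ, Measurable x ∧ (∀ s, x s ∈ Icc P.M₂ P.M₁) ∧ P.op x = x := by
  set θ := P.A / P.aL * P.bM * K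
  have hθ0 : 0 ≤ θ :=
    mul_nonneg (mul_nonneg (div_nonneg A_pos.le h.aL_pos.le) h.bM_nonneg) hK0
  have hM := h.M₂_le_M₁
  let X : ℕ → ℝ → ℝ := fun n => (P.op)^[n] fun _ => P.M₁
  have hXs : ∀ n, X (n + 1) = P.op (X n) := fun n => Function.iterate_succ_apply' _ _ _
  have hX : ∀ n, Measurable (X n) ∧ ∀ s, X n s ∈ Icc P.M₂ P.M₁ := by
    intro n
    induction n with
    | zero => exact ⟨measurable_const, fun _ => ⟨hM, le_rfl⟩⟩
    | succ n ih =>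
      rw [hXs]
      have h0 : ∀ s, 0 ≤ X n s := fun s => hM₂.le.trans (ih.2 s).1
      exact ⟨h.measurable_op ih.1 h0, fun s => ⟨h.le_op ih.1 h0 (fun s => (ih.2 s).2) s,
        h.op_le ih.1 h0 s⟩⟩
  have hX0 : ∀ n s, 0 ≤ X n s := fun n s => hM₂.le.trans ((hX n).2 s).1
  have hcontr : ∀ x y : ℝ → ℝ, Measurable x → Measurable y → (∀ s, x s ∈ Icc P.M₂ P.M₁) →
      (∀ s, y s ∈ Icc P.M₂ P.M₁) → ∀ D, (∀ s, |x s - y s| ≤ D) → ∀ s,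
      |P.op x s - P.op y s| ≤ θ * D := by
    intro x y hxm hym hx hy D hD s
    refine (h.abs_op_sub_le hxm (fun s => hM₂.le.trans (hx s).1) hym
      (fun s => hM₂.le.trans (hy s).1) (D := K * D) (fun s => ?_) s).trans_eq (by ring)
    exact (hK _ (hx s) _ (hy s)).trans (mul_le_mul_of_nonneg_left (hD s) hK0)
  have hstep : ∀ n s, dist (X n s) (X (n + 1) s) ≤ P.M₁ * θ ^ n := by
    intro n
    induction n with
    | zero =>
      intro s
      have h1 := (hX 0).2 s
      have h2 := (hX 1).2 s
      rw [Real.dist_eq, pow_zero, mul_one, abs_le]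
      constructor <;> linarith [h1.1, h1.2, h2.1, h2.2]
    | succ n ih =>
      intro s
      rw [hXs n, hXs (n + 1), Real.dist_eq]
      exact (hcontr _ _ (hX n).1 (hX (n + 1)).1 (hX n).2 (hX (n + 1)).2 _ ih s).trans_eq
        (by ring)
  choose x hx using fun s =>
    cauchySeq_tendsto_of_complete (cauchySeq_of_le_geometric θ P.M₁ hθ fun n => hstep n s)
  have hxm : Measurable x :=
    measurable_of_tendsto_metrizable (fun n => (hX n).1) (tendsto_pi_nhds.2 hx)
  have hxI : ∀ s, x s ∈ Icc P.M₂ P.M₁ := fun s =>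
    isClosed_Icc.mem_of_tendsto (hx s) (Eventually.of_forall fun n => (hX n).2 s)
  refine ⟨x, hxm, hxI, funext fun s => ?_⟩
  have h1 : ∀ n s, |X n s - x s| ≤ P.M₁ * θ ^ n / (1 - θ) := fun n s =>
    dist_le_of_le_geometric_of_tendsto θ P.M₁ hθ (fun n => hstep n s) (hx s) n
  have h2 : Tendsto (fun n => X (n + 1) s) atTop (𝓝 (P.op x s)) := by
    rw [tendsto_iff_dist_tendsto_zero]
    refine squeeze_zero (fun _ => dist_nonneg)
      (g := fun n => θ * (P.M₁ * θ ^ n / (1 - θ))) (fun n => ?_) ?_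
    · rw [hXs n]
      exact hcontr _ _ (hX n).1 hxm (hX n).2 hxI _ (h1 n) s
    · have := (((tendsto_pow_atTop_nhds_zero_of_lt_one hθ0 hθ).const_mul P.M₁).div_const
        (1 - θ)).const_mul θ
      simpa using this
  exact tendsto_nhds_unique h2 ((tendsto_add_atTop_iff_nat 1).2 (hx s))

lemma idx_eventually_left (s : ℝ) : ∀ᶠ r in 𝓝[≤] s, P.idx r = P.idx s := by
  obtain ⟨h1, h2⟩ := h.idx_spec s
  filter_upwards [Ioc_mem_nhdsLE h1] with r hr
  exact h.idx_eq hr.1 (hr.2.trans h2)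

lemma idx_eventually {s : ℝ} (hs : s ∉ range P.t) : ∀ᶠ r in 𝓝 s, P.idx r = P.idx s := by
  obtain ⟨h1, h2⟩ := h.idx_spec s
  have h3 : s < P.t (P.idx s) := h2.lt_of_ne fun e => hs ⟨_, e.symm⟩
  filter_upwards [Ioo_mem_nhds h1 h3] with r hr
  exact h.idx_eq hr.1 hr.2.le

lemma idx_eventually_right (k : ℤ) : ∀ᶠ r in 𝓝[>] (P.t k), P.idx r = k + 1 := by
  have h1 : P.t k < P.t (k + 1) := h.t_strictMono (by omega)
  filter_upwards [Ioo_mem_nhdsGT h1] with r hr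
  exact h.idx_eq (by rw [add_sub_cancel_right]; exact hr.1) hr.2.le

lemma logFund_eventually {s : ℝ} (hs : s ∉ range P.t) :
    P.logFund =ᶠ[𝓝 s] fun r => P.lg (P.idx s) - ∫ u in (0 : ℝ)..r, P.a u :=
  (h.idx_eventually hs).mono fun _ hr => logFund_eq_of_idx hr

lemma hasDerivAt_branch (k : ℤ) (s : ℝ) :
    HasDerivAt (fun r => P.lg k - ∫ u in (0 : ℝ)..r, P.a u) (-P.a s) s :=
  (h.a_ap.1.integral_hasStrictDerivAt 0 s).hasDerivAt.const_sub _

lemma hasDerivAt_logFund {s : ℝ} (hs : s ∉ range P.t) : HasDerivAt P.logFund (-P.a s) s :=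
  (h.hasDerivAt_branch _ s).congr_of_eventuallyEq (h.logFund_eventually hs)

lemma exp_logFundRight (k : ℤ) :
    Real.exp (P.logFundRight k) = (1 + P.γ k) * Real.exp (P.logFund (P.t k)) := by
  rw [logFundRight, lg_succ, logFund, h.idx_t, add_sub_right_comm, Real.exp_add,
    Real.exp_log (h.one_add_γ_pos k), mul_comm]

lemma tendsto_logFund_right (k : ℤ) :
    Tendsto P.logFund (𝓝[>] (P.t k)) (𝓝 (P.logFundRight k)) := by
  have h1 := (h.hasDerivAt_branch (k + 1) (P.t k)).continuousAt.tendsto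
  refine (h1.mono_left nhdsWithin_le_nhds).congr' ?_
  exact (h.idx_eventually_right k).mono fun r hr => (logFund_eq_of_idx hr).symm

lemma continuousWithinAt_logFund (s : ℝ) : ContinuousWithinAt P.logFund (Iic s) s := by
  have h1 := (h.hasDerivAt_branch (P.idx s) s).continuousAt.continuousWithinAt (s := Iic s)
  refine h1.congr_of_eventuallyEq ?_ rfl
  exact (h.idx_eventually_left s).mono fun r hr => logFund_eq_of_idx hr

/-- The fixed point is only known to be measurable, but `op_eq` writes it as the exponential of
`logFund` times a continuous function plus a function that is constant between instants. This gives
continuity off the instants; then `feed x` is continuous wherever neither `s` nor `s - τ` is an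
instant, and the fundamental theorem of calculus applies there. -/
lemma isSolution_of_fixed_point {x : ℝ → ℝ} (hxm : Measurable x) (hx0 : ∀ s, 0 ≤ x s)
    (hfix : P.op x = x) : P.IsSolution x := by
  have hJc := h.continuous_accum hxm hx0
  have hxe : ∀ s, x s = Real.exp (P.logFund s) * (P.accum x s + P.jumpCoeff (P.idx s)) :=
    fun s => (congrFun hfix s).symm.trans (op_eq x s)
  have hev : ∀ s, s ∉ range P.t → x =ᶠ[𝓝 s] fun r => Real.exp (P.logFund r) *
      (P.accum x r + P.jumpCoeff (P.idx s)) := fun s hs =>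
    (h.idx_eventually hs).mono fun r hr => by rw [hxe r, hr]
  have hxc : ∀ s, s ∉ range P.t → ContinuousAt x s := fun s hs => by
    refine ContinuousAt.congr ?_ (hev s hs).symm
    exact (h.hasDerivAt_logFund hs).continuousAt.rexp.mul
      (hJc.continuousAt.add continuousAt_const)
  have hright : ∀ k, Tendsto x (𝓝[>] (P.t k)) (𝓝 (x (P.t k) + (P.γ k * x (P.t k) + P.δ k))) := by
    intro k
    have h1 : Tendsto (fun r => Real.exp (P.logFund r) * (P.accum x r + P.jumpCoeff (k + 1)))
        (𝓝[>] (P.t k)) (𝓝 (Real.exp (P.logFundRight k) * (P.accum x (P.t k) + P.jumpCoeff (k + 1)))) :=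
      ((Real.continuous_exp.tendsto _).comp (h.tendsto_logFund_right k)).mul
        ((hJc.continuousAt.tendsto.mono_left nhdsWithin_le_nhds).add_const _)
    have e : Real.exp (P.logFundRight k) * (P.accum x (P.t k) + P.jumpCoeff (k + 1)) =
        x (P.t k) + (P.γ k * x (P.t k) + P.δ k) := by
      rw [hxe (P.t k), h.idx_t, h.jumpCoeff_succ]
      have e1 : Real.exp (P.logFundRight k) * Real.exp (-P.logFundRight k) = 1 := by
        rw [← Real.exp_add, add_neg_cancel, Real.exp_zero]
      have e2 := h.exp_logFundRight k
      linear_combination P.δ k * e1 + (P.accum x (P.t k) + P.jumpCoeff k) * e2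
    rw [e] at h1
    refine h1.congr' ((h.idx_eventually_right k).mono fun r hr => ?_)
    rw [hxe r, hr]
  refine ⟨⟨fun s _ => ?_, fun s _ hs => (hxc s hs).continuousWithinAt, fun k _ =>
    ⟨_, by rw [univ_inter]; exact hright k⟩⟩, hx0, fun s hs hsτ => ?_, hright⟩
  · rw [univ_inter]
    have h1 : ContinuousWithinAt (fun r => Real.exp (P.logFund r) *
        (P.accum x r + P.jumpCoeff (P.idx s))) (Iic s) s :=
      (h.continuousWithinAt_logFund s).rexp.mul
        (hJc.continuousWithinAt.add continuousWithinAt_const)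
    refine h1.congr_of_eventuallyEq ?_ (hxe s)
    exact (h.idx_eventually_left s).mono fun r hr => by rw [hxe r, hr]
  · have hgc : ContinuousAt (fun r => Real.exp (-P.logFund r) * P.feed x r) s := by
      have e : P.feed x = fun r => P.b r * P.hill (x (r - P.τ)) := funext fun r => feed_eq x r
      rw [e]
      have h2 : ContinuousAt (fun r => x (r - P.τ)) s :=
        ContinuousAt.comp (f := fun r => r - P.τ) (hxc _ hsτ) (by fun_prop)
      exact (h.hasDerivAt_logFund hs).continuousAt.neg.rexp.mul
        (h.b_ap.1.continuousAt.mul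
          (ContinuousAt.comp (f := fun r => x (r - P.τ)) (h.continuousAt_hill (hx0 _)) h2))
    have hgm : Measurable fun r => Real.exp (-P.logFund r) * P.feed x r :=
      (Real.measurable_exp.comp h.measurable_logFund.neg).mul (h.measurable_feed hxm)
    have hJd : HasDerivAt (P.accum x) (Real.exp (-P.logFund s) * P.feed x s) s := by
      rw [h.accum_eq hxm hx0]
      exact (intervalIntegral.integral_hasDerivAt_right (h.intervalIntegrable_accum hxm hx0 0 s)
        (hgm.stronglyMeasurable.stronglyMeasurableAtFilter) hgc).add_const _
    have hd := ((h.hasDerivAt_logFund hs).exp.mul (hJd.add_const (P.jumpCoeff (P.idx s))))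
    refine (hd.congr_of_eventuallyEq (hev s hs)).congr_deriv ?_
    rw [rhs_eq, hxe s]
    have e1 : Real.exp (P.logFund s) * Real.exp (-P.logFund s) = 1 := by
      rw [← Real.exp_add, add_neg_cancel, Real.exp_zero]
    linear_combination P.feed x s * e1

end Admissible
end HematopoiesisModel

/-! ### Variation of constants for initial value problems. -/

lemma integral_exp_neg_mul_sub_interval {c : ℝ} (hc : c ≠ 0) (s s' : ℝ) :
    ∫ r in s..s', Real.exp (-c * (s' - r)) = (1 - Real.exp (-c * (s' - s))) / c := by
  have hd : ∀ r ∈ uIcc s s', HasDerivAt (fun r => Real.exp (-c * (s' - r)) / c)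
      (Real.exp (-c * (s' - r))) r := fun r _ => by
    have h1 : HasDerivAt (fun r => -c * (s' - r)) c r := by
      simpa using ((hasDerivAt_id r).const_sub s').const_mul (-c)
    refine (h1.exp.div_const c).congr_deriv ?_
    field_simp
  rw [intervalIntegral.integral_eq_sub_of_hasDerivAt hd
    (Continuous.intervalIntegrable (by fun_prop) _ _)]
  simp [sub_div]

namespace HematopoiesisModel

variable {P : HematopoiesisModel}

/-- Nonnegative solutions on `[t₀ - τ, ∞)` of the variation of constants formula. -/
structure IsMild (P : HematopoiesisModel) (t₀ : ℝ) (y : ℝ → ℝ) : Prop where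
  nonneg : ∀ s, t₀ - P.τ ≤ s → 0 ≤ y s
  integrable : ∀ s s', t₀ ≤ s → s ≤ s' → IntervalIntegrable
    (fun r => Real.exp (P.logFund s' - P.logFund r) * P.feed y r) MeasureTheory.volume s s'
  formula : ∀ s s', t₀ ≤ s → s ≤ s' → y s' - P.jumpResponse s' =
    Real.exp (P.logFund s' - P.logFund s) * (y s - P.jumpResponse s) +
      ∫ r in s..s', Real.exp (P.logFund s' - P.logFund r) * P.feed y r

/-- The integral formula can be restarted at any later time, without checking that the solution is
positive there, as `IsSolutionFrom` would require. -/
lemma IsMild.mono {t₀ t₁ : ℝ} {y : ℝ → ℝ} (hy : P.IsMild t₀ y) (ht : t₀ ≤ t₁) : P.IsMild t₁ y :=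
  ⟨fun s hs => hy.nonneg s (by linarith), fun s s' hs => hy.integrable s s' (ht.trans hs),
    fun s s' hs => hy.formula s s' (ht.trans hs)⟩

lemma IsSolution.isSolutionFrom {y : ℝ → ℝ} (hy : P.IsSolution y) {t₀ : ℝ} (h0 : 0 < y t₀) :
    P.IsSolutionFrom t₀ y where
  plc :=
    { left_cont := fun s _ => (hy.plc.left_cont s (mem_univ _)).mono
        (inter_subset_inter_left _ (subset_univ _))
      cont := fun s _ hs => (hy.plc.cont s (mem_univ _) hs).mono (subset_univ _)
      right_lim := fun k _ => by
        obtain ⟨l, hl⟩ := hy.plc.right_lim k (mem_univ _)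
        exact ⟨l, hl.mono_left (nhdsWithin_mono _ (inter_subset_inter_left _ (subset_univ _)))⟩ }
  nonneg s _ := hy.nonneg s
  init_pos := h0
  ode s _ := hy.ode s
  jump k _ := hy.jump k

namespace Admissible

variable (h : P.Admissible)
include h

/-- Division by the fundamental solution and subtraction of `jumpCoeff` removes the jumps. -/
lemma continuousOn_reduced {t₀ : ℝ} {y : ℝ → ℝ} (hy : P.IsSolutionFrom t₀ y) :
    ContinuousOn (fun s => Real.exp (-P.logFund s) * y s - P.jumpCoeff (P.idx s)) (Ici t₀) := by
  have hsub : Ici t₀ ⊆ Ici (t₀ - P.τ) := Ici_subset_Ici.2 (by linarith [h.τ_nonneg])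
  intro s hs
  by_cases hr : s ∈ range P.t
  · obtain ⟨k, rfl⟩ := hr
    have hl : ContinuousWithinAt (fun s => Real.exp (-P.logFund s) * y s - P.jumpCoeff (P.idx s))
        (Ici (t₀ - P.τ) ∩ Iic (P.t k)) (P.t k) := by
      refine ContinuousWithinAt.sub ?_ ?_
      · exact ((h.continuousWithinAt_logFund _).mono inter_subset_right).neg.rexp.mul
          (hy.plc.left_cont _ (hsub hs))
      · refine (continuousWithinAt_const (b := P.jumpCoeff (P.idx (P.t k)))).congr_of_eventuallyEq
          ?_ rfl
        exact ((h.idx_eventually_left _).filter_mono (nhdsWithin_mono _ inter_subset_right)).mono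
          fun r hr => by simp only [hr]
    have hr : ContinuousWithinAt (fun s => Real.exp (-P.logFund s) * y s - P.jumpCoeff (P.idx s))
        (Ioi (P.t k)) (P.t k) := by
      have h1 : Tendsto (fun s => Real.exp (-P.logFund s) * y s - P.jumpCoeff (k + 1))
          (𝓝[>] (P.t k)) (𝓝 (Real.exp (-P.logFundRight k) *
            (y (P.t k) + (P.γ k * y (P.t k) + P.δ k)) - P.jumpCoeff (k + 1))) :=
        (((Real.continuous_exp.tendsto _).comp (h.tendsto_logFund_right k).neg).mul
          (hy.jump k hs)).sub_const _
      have e : Real.exp (-P.logFundRight k) *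
            (y (P.t k) + (P.γ k * y (P.t k) + P.δ k)) - P.jumpCoeff (k + 1) =
          Real.exp (-P.logFund (P.t k)) * y (P.t k) - P.jumpCoeff (P.idx (P.t k)) := by
        rw [h.idx_t, h.jumpCoeff_succ]
        have e1 : Real.exp (-P.logFundRight k) * (1 + P.γ k) = Real.exp (-P.logFund (P.t k)) := by
          have e2 := h.exp_logFundRight k
          have := h.one_add_γ_pos k
          rw [Real.exp_neg, Real.exp_neg, e2]
          field_simp
        linear_combination y (P.t k) * e1
      rw [e] at h1
      refine h1.congr' ((h.idx_eventually_right k).mono fun r hr => ?_)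
      simp only [hr]
    refine (hl.union hr).mono fun r hr' => ?_
    rcases le_or_gt r (P.t k) with h2 | h2
    · exact Or.inl ⟨hsub hr', h2⟩
    · exact Or.inr h2
  · refine ContinuousWithinAt.sub ?_ ?_
    · exact (h.hasDerivAt_logFund hr).continuousAt.continuousWithinAt.neg.rexp.mul
        ((hy.plc.cont s (hsub hs) hr).mono hsub)
    · refine (continuousWithinAt_const (b := P.jumpCoeff (P.idx s))).congr_of_eventuallyEq ?_ rfl
      exact ((h.idx_eventually hr).filter_mono nhdsWithin_le_nhds).mono
          fun r hr => by simp only [hr]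

lemma hasDerivAt_reduced {t₀ : ℝ} {y : ℝ → ℝ} (hy : P.IsSolutionFrom t₀ y) {s : ℝ} (hs : t₀ < s)
    (hs1 : s ∉ range P.t) (hs2 : s - P.τ ∉ range P.t) :
    HasDerivAt (fun s => Real.exp (-P.logFund s) * y s - P.jumpCoeff (P.idx s))
      (Real.exp (-P.logFund s) * P.feed y s) s := by
  have hd := (((h.hasDerivAt_logFund hs1).fun_neg.exp.mul (hy.ode s hs hs1 hs2)).sub_const
    (P.jumpCoeff (P.idx s)))
  refine (hd.congr_of_eventuallyEq ?_).congr_deriv ?_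
  · exact (h.idx_eventually hs1).mono fun r hr => by simp only [hr]; rfl
  · rw [rhs_eq]
    ring

-- The reduced function of `continuousOn_reduced` is continuous and differentiable off a countable
-- set, so the fundamental theorem of calculus holds for it across all instants at once.
open MeasureTheory in
lemma isMild {t₀ : ℝ} {y : ℝ → ℝ} (hy : P.IsSolutionFrom t₀ y) : P.IsMild t₀ y := by
  set v := fun s => Real.exp (-P.logFund s) * y s - P.jumpCoeff (P.idx s) with hv
  set S : Set ℝ := range P.t ∪ (fun r => r - P.τ) ⁻¹' range P.t
  have hS : S.Countable := (countable_range _).union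
    ((countable_range P.t).preimage fun a b hab => by simpa using hab)
  have hder : ∀ s, t₀ < s → s ∉ S → HasDerivAt v (Real.exp (-P.logFund s) * P.feed y s) s :=
    fun s hs hsS => h.hasDerivAt_reduced hy hs (fun hc => hsS (Or.inl hc))
      (fun hc => hsS (Or.inr hc))
  have hii : ∀ s s', t₀ ≤ s → s ≤ s' → IntervalIntegrable
      (fun r => Real.exp (-P.logFund r) * P.feed y r) volume s s' := by
    intro s s' hs hss
    rw [intervalIntegrable_iff_integrableOn_Ioc_of_le hss]
    refine Integrable.mono' (g := fun _ => Real.exp (-P.logFund s') * (P.A * P.bM))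
      (integrableOn_const (by simp)) ?_ ?_
    -- The integrand agrees almost everywhere with a derivative, and derivatives are measurable; no
    -- separate measurability of `y` is needed.
    · refine (measurable_deriv v).aestronglyMeasurable.congr ?_
      filter_upwards [ae_restrict_mem measurableSet_Ioc, ae_restrict_of_ae (hS.ae_notMem volume)]
        with r hr hrS
      exact (hder r (hs.trans_lt hr.1) hrS).deriv
    · refine (ae_restrict_iff' measurableSet_Ioc).2 (ae_of_all _ fun r hr => ?_)
      have h1 := h.abs_feed_le (hy.nonneg (r - P.τ) (by linarith [hr.1]))
      have h2 := h.weight_le hr.2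
      have h3 : Real.exp (P.logFund s' - P.logFund r) ≤ P.A := by
        refine h2.trans (mul_le_of_le_one_right A_pos.le (Real.exp_le_one_iff.2 ?_))
        have := mul_nonneg h.aL_pos.le (sub_nonneg.2 hr.2)
        linarith
      rw [norm_mul, Real.norm_of_nonneg (Real.exp_pos _).le,
        show -P.logFund r = -P.logFund s' + (P.logFund s' - P.logFund r) by ring, Real.exp_add,
        mul_assoc]
      exact mul_le_mul_of_nonneg_left
        (mul_le_mul h3 h1 (norm_nonneg _) A_pos.le) (Real.exp_pos _).le
  have hmul : ∀ s', (fun r => Real.exp (P.logFund s' - P.logFund r) * P.feed y r) =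
      fun r => Real.exp (P.logFund s') * (Real.exp (-P.logFund r) * P.feed y r) := fun s' => by
    ext r
    rw [sub_eq_add_neg, Real.exp_add, mul_assoc]
  refine ⟨hy.nonneg, fun s s' hs hss => ?_, fun s s' hs hss => ?_⟩
  · rw [hmul]
    exact (hii s s' hs hss).const_mul _
  · have hftc := integral_eq_of_hasDerivAt_off_countable_of_le v _ hss hS
      ((h.continuousOn_reduced hy).mono fun r hr => hs.trans hr.1)
      (fun r hr => hder r (hs.trans_lt hr.1.1) hr.2) (hii s s' hs hss)
    have hyv : ∀ r, y r - P.jumpResponse r = Real.exp (P.logFund r) * v r := fun r => by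
      rw [jumpResponse_eq, hv]
      have e1 : Real.exp (P.logFund r) * Real.exp (-P.logFund r) = 1 := by
        rw [← Real.exp_add, add_neg_cancel, Real.exp_zero]
      linear_combination -y r * e1
    rw [hmul, intervalIntegral.integral_const_mul, hftc, hyv, hyv, ← mul_assoc, ← Real.exp_add,
      sub_add_cancel]
    ring

lemma integral_weight_feed_le {t₀ : ℝ} {y : ℝ → ℝ} (hy : P.IsMild t₀ y) {s s' : ℝ} (hs : t₀ ≤ s)
    (hss : s ≤ s') : ∫ r in s..s', Real.exp (P.logFund s' - P.logFund r) * P.feed y r ≤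
      ∫ r in s..s', P.A * Real.exp (-P.aL * (s' - r)) * P.bM := by
  refine intervalIntegral.integral_mono_on hss (hy.integrable s s' hs hss)
    (Continuous.intervalIntegrable (by fun_prop) _ _) fun r hr => ?_
  have h0 := hy.nonneg (r - P.τ) (by linarith [hr.1])
  exact mul_le_mul (h.weight_le hr.2) (h.feed_le h0) (h.feed_nonneg h0)
    (mul_nonneg A_pos.le (Real.exp_pos _).le)

lemma mild_upper {t₀ S : ℝ} {y : ℝ → ℝ} (hy : P.IsMild t₀ y) (hS : ∀ s, |P.jumpResponse s| ≤ S)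
    {s : ℝ} (hs : t₀ ≤ s) :
    y s ≤ P.M₁ + P.A * Real.exp (-P.aL * (s - t₀)) * (y t₀ + S) := by
  have h1 := hy.formula t₀ s le_rfl hs
  have h2 := h.integral_weight_feed_le hy le_rfl hs
  rw [intervalIntegral.integral_mul_const, intervalIntegral.integral_const_mul,
    integral_exp_neg_mul_sub_interval h.aL_pos.ne'] at h2
  have h3 : P.A * ((1 - Real.exp (-P.aL * (s - t₀))) / P.aL) * P.bM ≤ P.A / P.aL * P.bM := by
    have e : P.A / P.aL * P.bM = P.A * (1 / P.aL) * P.bM := by ring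
    rw [e]
    have := h.aL_pos
    have := h.bM_nonneg
    have := A_pos (P := P)
    gcongr
    linarith [Real.exp_pos (-P.aL * (s - t₀))]
  have h4 : Real.exp (P.logFund s - P.logFund t₀) * (y t₀ - P.jumpResponse t₀) ≤
      P.A * Real.exp (-P.aL * (s - t₀)) * (y t₀ + S) := by
    have h5 := abs_le.1 (hS t₀)
    have h6 := hy.nonneg t₀ (by linarith [h.τ_nonneg])
    calc _ ≤ Real.exp (P.logFund s - P.logFund t₀) * (y t₀ + S) :=
          mul_le_mul_of_nonneg_left (by linarith) (Real.exp_pos _).le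
      _ ≤ _ := mul_le_mul_of_nonneg_right (h.weight_le hs)
          (by linarith [(abs_nonneg _).trans (hS t₀)])
  have h7 := h.jumpResponse_le s
  rw [M₁_eq]
  linarith

/-- An upper bound `U` of `y` gives a lower bound of the production term, since the Hill function
decreases. Nonnegativity of `y t₀` leaves only `-S` to be bounded in the homogeneous part. -/
lemma mild_lower {t₀ S U : ℝ} {y : ℝ → ℝ} (hy : P.IsMild t₀ y) (hS : ∀ s, |P.jumpResponse s| ≤ S)
    (hU : ∀ s, t₀ - P.τ ≤ s → y s ≤ U) {s : ℝ} (hs : t₀ ≤ s) :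
    P.jumpLower + P.B / P.aM * (P.bL / (1 + U ^ P.α)) * (1 - Real.exp (-P.aM * (s - t₀))) -
      P.A * Real.exp (-P.aL * (s - t₀)) * S ≤ y s := by
  have h1 := hy.formula t₀ s le_rfl hs
  have hτ := h.τ_nonneg
  have h0 := hy.nonneg t₀ (by linarith)
  have hU0 : 0 ≤ U := h0.trans (hU t₀ (by linarith))
  set K := P.bL / (1 + U ^ P.α)
  have hK : 0 ≤ K := div_nonneg h.bL_nonneg (one_pos.le.trans (one_le_one_add_rpow hU0))
  have h2 : ∫ r in t₀..s, P.B * Real.exp (-P.aM * (s - r)) * K ≤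
      ∫ r in t₀..s, Real.exp (P.logFund s - P.logFund r) * P.feed y r := by
    refine intervalIntegral.integral_mono_on hs (Continuous.intervalIntegrable (by fun_prop) _ _)
      (hy.integrable t₀ s le_rfl hs) fun r hr => ?_
    exact mul_le_mul (h.le_weight hr.2) (h.le_feed (hy.nonneg _ (by linarith [hr.1]))
      (hU _ (by linarith [hr.1]))) hK (Real.exp_pos _).le
  rw [intervalIntegral.integral_mul_const, intervalIntegral.integral_const_mul,
    integral_exp_neg_mul_sub_interval h.aM_pos.ne'] at h2
  have h4 : -(P.A * Real.exp (-P.aL * (s - t₀)) * S) ≤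
      Real.exp (P.logFund s - P.logFund t₀) * (y t₀ - P.jumpResponse t₀) := by
    have h5 := abs_le.1 (hS t₀)
    have hS0 := (abs_nonneg _).trans (hS t₀)
    calc _ ≤ Real.exp (P.logFund s - P.logFund t₀) * (-S) := by
          rw [mul_neg]
          exact neg_le_neg (mul_le_mul_of_nonneg_right (h.weight_le hs) hS0)
      _ ≤ _ := mul_le_mul_of_nonneg_left (by linarith) (Real.exp_pos _).le
  have h7 := h.jumpLower_le s
  have e : P.B * ((1 - Real.exp (-P.aM * (s - t₀))) / P.aM) * K =
    P.B / P.aM * K * (1 - Real.exp (-P.aM * (s - t₀))) := by ring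
  linarith

/-- Growth or decay of the difference of two solutions along which the Hill function is Lipschitz
with constant `K`. The rate `c` may be negative. -/
lemma mild_diff_le {t₀ c K M r : ℝ} {x y : ℝ → ℝ} (hx : P.IsMild t₀ x) (hy : P.IsMild t₀ y)
    (hK0 : 0 ≤ K)
    (hK : ∀ s, t₀ - P.τ ≤ s → |P.hill (y s) - P.hill (x s)| ≤ K * |y s - x s|)
    (hM : ∀ s, t₀ - P.τ ≤ s → |y s - x s| ≤ M)
    (hr : ∀ s ∈ Icc (t₀ - P.τ) t₀, |y s - x s| ≤ r) (hc : c < P.aL)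
    (hθ : P.A * P.bM * K * Real.exp (c * P.τ) / (P.aL - c) < 1) {s : ℝ} (hs : t₀ ≤ s) :
    |y s - x s| ≤ (P.A + Real.exp (|c| * P.τ)) /
      (1 - P.A * P.bM * K * Real.exp (c * P.τ) / (P.aL - c)) * r * Real.exp (-c * (s - t₀)) := by
  set θ := P.A * P.bM * K * Real.exp (c * P.τ) / (P.aL - c) with hθdef
  set C := (P.A + Real.exp (|c| * P.τ)) / (1 - θ) with hC
  have hτ := h.τ_nonneg
  have hA := A_pos (P := P)
  have hbM := h.bM_nonneg
  have hac : 0 < P.aL - c := sub_pos.2 hc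
  have hθ0 : 0 ≤ θ := by positivity
  have hr0 : 0 ≤ r := (abs_nonneg _).trans (hr t₀ ⟨by linarith, le_rfl⟩)
  have hM0 : 0 ≤ M := (abs_nonneg _).trans (hM t₀ (by linarith))
  -- The value of `C` is dictated by two requirements: `e^{|c| τ} ≤ C`, for the initial interval,
  -- and `A + θ C ≤ C`, for the induction step.
  have hCθ : P.A + Real.exp (|c| * P.τ) = (1 - θ) * C := by
    rw [hC]; field_simp [(sub_pos.2 hθ).ne']
  have hC0 : 0 ≤ C := div_nonneg (by positivity) (sub_pos.2 hθ).le
  have hCexp : Real.exp (|c| * P.τ) ≤ C := by nlinarith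
  have hCA : P.A + θ * C ≤ C := by nlinarith [Real.exp_pos (|c| * P.τ)]
  -- The horizon `s` is fixed, so the crude bound `M` can be converted into a multiple of `e^{-c (u
  -- - t₀)}` on the whole window. Its dependence on `s` is harmless, as `θ ^ n * Q` tends to `0`.
  set Q := M * Real.exp (|c| * (s - t₀ + P.τ))
  have key : ∀ n : ℕ, ∀ u ∈ Icc (t₀ - P.τ) s,
      |y u - x u| ≤ (θ ^ n * Q + C * r) * Real.exp (-c * (u - t₀)) := by
    intro n
    induction n with
    | zero =>
      intro u hu
      have h1 : 1 ≤ Real.exp (|c| * (s - t₀ + P.τ)) * Real.exp (-c * (u - t₀)) := by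
        rw [← Real.exp_add, Real.one_le_exp_iff]
        have h2 : |c * (u - t₀)| ≤ |c| * (s - t₀ + P.τ) := by
          rw [abs_mul]
          refine mul_le_mul_of_nonneg_left ?_ (abs_nonneg _)
          rw [abs_le]
          constructor <;> linarith [hu.1, hu.2]
        linarith [(abs_le.1 h2).2]
      have h3 := hM u hu.1
      have h4 : 0 ≤ C * r * Real.exp (-c * (u - t₀)) := by positivity
      have h5 := mul_le_mul_of_nonneg_left h1 hM0
      rw [pow_zero, one_mul, add_mul]
      linarith
    | succ n ih =>
      intro u hu
      rcases le_or_gt u t₀ with hut | hut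
      · have h1 : 1 ≤ Real.exp (|c| * P.τ) * Real.exp (-c * (u - t₀)) := by
          rw [← Real.exp_add, Real.one_le_exp_iff]
          have h2 : |c * (u - t₀)| ≤ |c| * P.τ := by
            rw [abs_mul]
            refine mul_le_mul_of_nonneg_left ?_ (abs_nonneg _)
            rw [abs_le]
            constructor <;> linarith [hu.1]
          linarith [(abs_le.1 h2).2]
        have h2 : 1 ≤ C * Real.exp (-c * (u - t₀)) :=
          h1.trans (mul_le_mul_of_nonneg_right hCexp (Real.exp_pos _).le)
        have h3 := hr u ⟨hu.1, hut⟩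
        have h4 : 0 ≤ θ ^ (n + 1) * Q * Real.exp (-c * (u - t₀)) := by positivity
        have h5 := mul_le_mul_of_nonneg_left h2 hr0
        rw [add_mul]
        linarith
      · set G := θ ^ n * Q + C * r
        have hG0 : 0 ≤ G := by positivity
        have e1 := hx.formula t₀ u le_rfl hut.le
        have e2 := hy.formula t₀ u le_rfl hut.le
        have hsub := intervalIntegral.integral_sub (hy.integrable t₀ u le_rfl hut.le)
          (hx.integrable t₀ u le_rfl hut.le)
        have e3 : y u - x u = Real.exp (P.logFund u - P.logFund t₀) * (y t₀ - x t₀) +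
            ∫ w in t₀..u, (Real.exp (P.logFund u - P.logFund w) * P.feed y w -
              Real.exp (P.logFund u - P.logFund w) * P.feed x w) := by
          rw [hsub]; linear_combination e2 - e1
        have h1 : ‖∫ w in t₀..u, (Real.exp (P.logFund u - P.logFund w) * P.feed y w -
              Real.exp (P.logFund u - P.logFund w) * P.feed x w)‖ ≤
            ∫ w in t₀..u, P.A * P.bM * K * Real.exp (c * P.τ) * G * Real.exp (-c * (u - t₀)) *
              Real.exp (-(P.aL - c) * (u - w)) := by
          refine intervalIntegral.norm_integral_le_of_norm_le hut.le
            (MeasureTheory.ae_of_all _ fun w hw => ?_)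
            (Continuous.intervalIntegrable (by fun_prop) _ _)
          have h2 := ih (w - P.τ) ⟨by linarith [hw.1], by linarith [hw.2, hu.2]⟩
          have h3 := hK (w - P.τ) (by linarith [hw.1])
          rw [← mul_sub, norm_mul, Real.norm_of_nonneg (Real.exp_pos _).le, feed_eq, feed_eq,
            ← mul_sub, norm_mul, Real.norm_of_nonneg (h.b_nonneg w), Real.norm_eq_abs]
          calc _ ≤ P.A * Real.exp (-P.aL * (u - w)) *
                (P.bM * (K * (G * Real.exp (-c * (w - P.τ - t₀))))) := by
                refine mul_le_mul (h.weight_le hw.2) (mul_le_mul (h.le_bM w)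
                  (h3.trans (mul_le_mul_of_nonneg_left h2 hK0)) (abs_nonneg _) hbM)
                  (mul_nonneg (h.b_nonneg w) (abs_nonneg _)) (by positivity)
            _ = P.A * P.bM * K * G * (Real.exp (-P.aL * (u - w)) *
                Real.exp (-c * (w - P.τ - t₀))) := by ring
            _ = P.A * P.bM * K * G * (Real.exp (c * P.τ) * Real.exp (-c * (u - t₀)) *
                Real.exp (-(P.aL - c) * (u - w))) := by
                rw [← Real.exp_add, ← Real.exp_add, ← Real.exp_add]
                congr 2
                ring
            _ = _ := by ring
        rw [intervalIntegral.integral_const_mul,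
          integral_exp_neg_mul_sub_interval hac.ne'] at h1
        have h4 : P.A * P.bM * K * Real.exp (c * P.τ) * G * Real.exp (-c * (u - t₀)) *
            ((1 - Real.exp (-(P.aL - c) * (u - t₀))) / (P.aL - c)) ≤
            θ * G * Real.exp (-c * (u - t₀)) := by
          have e4 : θ * G * Real.exp (-c * (u - t₀)) = P.A * P.bM * K * Real.exp (c * P.τ) * G *
            Real.exp (-c * (u - t₀)) * (1 / (P.aL - c)) := by rw [hθdef]; ring
          rw [e4]
          gcongr
          linarith [Real.exp_pos (-(P.aL - c) * (u - t₀))]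
        have h5 : |Real.exp (P.logFund u - P.logFund t₀) * (y t₀ - x t₀)| ≤
            P.A * r * Real.exp (-c * (u - t₀)) := by
          rw [abs_mul, abs_of_pos (Real.exp_pos _)]
          calc _ ≤ P.A * Real.exp (-P.aL * (u - t₀)) * r :=
                mul_le_mul (h.weight_le hut.le) (hr t₀ ⟨by linarith, le_rfl⟩) (abs_nonneg _)
                  (by positivity)
            _ ≤ P.A * Real.exp (-c * (u - t₀)) * r := by
                have : -P.aL * (u - t₀) ≤ -c * (u - t₀) := by
                  have := mul_le_mul_of_nonneg_right hc.le (sub_nonneg.2 hut.le)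
                  linarith
                gcongr
            _ = _ := by ring
        rw [Real.norm_eq_abs] at h1
        rw [e3]
        refine (abs_add_le _ _).trans ((add_le_add h5 (h1.trans h4)).trans ?_)
        rw [← add_mul]
        refine mul_le_mul_of_nonneg_right ?_ (Real.exp_pos _).le
        have h6 := mul_le_mul_of_nonneg_right hCA hr0
        have e5 : θ * G = θ ^ (n + 1) * Q + θ * C * r := by simp only [G]; ring
        rw [e5]
        linarith
  have hlim : Tendsto (fun n : ℕ => (θ ^ n * Q + C * r) * Real.exp (-c * (s - t₀))) atTop
      (𝓝 ((0 * Q + C * r) * Real.exp (-c * (s - t₀)))) :=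
    (((tendsto_pow_atTop_nhds_zero_of_lt_one hθ0 hθ).mul_const Q).add_const _).mul_const _
  rw [zero_mul, zero_add] at hlim
  exact ge_of_tendsto' hlim fun n => key n s ⟨by linarith, le_rfl⟩

end Admissible
end HematopoiesisModel

/-! ### Absorption and exponential stability. -/

lemma exists_mul_exp_neg_le {c : ℝ} (hc : 0 < c) (K : ℝ) {ε : ℝ} (hε : 0 < ε) :
    ∃ T, 0 ≤ T ∧ ∀ u, T ≤ u → K * Real.exp (-c * u) ≤ ε := by
  have h1 : Tendsto (fun u : ℝ => K * Real.exp (-c * u)) atTop (𝓝 (K * 0)) := by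
    refine (Real.tendsto_exp_atBot.comp ?_).const_mul K
    exact tendsto_id.const_mul_atTop_of_neg (neg_lt_zero.2 hc)
  rw [mul_zero] at h1
  obtain ⟨T, hT⟩ := eventually_atTop.1 (h1.eventually (eventually_le_nhds hε))
  exact ⟨max T 0, le_max_right _ _, fun u hu => hT u ((le_max_left _ _).trans hu)⟩

namespace HematopoiesisModel

variable {P : HematopoiesisModel}

namespace Admissible

variable (h : P.Admissible)
include h

/-- The upper estimate comes first; fed into the decreasing production term it yields the lower one.
The time `T` depends on the initial value only through its bound `R`. -/
lemma exists_absorption {ε : ℝ} (hε : 0 < ε) (R : ℝ) : ∃ T, 0 ≤ T ∧ ∀ t₀ y, P.IsMild t₀ y →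
    y t₀ ≤ R → ∀ s, t₀ + T ≤ s → y s ∈ Icc (P.M₂ - ε) (P.M₁ + ε) := by
  obtain ⟨S, hS0, hS⟩ := h.exists_jumpResponse_bound
  have hA := A_pos (P := P)
  have hτ := h.τ_nonneg
  set φ : ℝ → ℝ := fun U => P.B / P.aM * (P.bL / (1 + U ^ P.α)) with hφ
  have hφc : ContinuousAt φ P.M₁ := by
    have := (Real.continuous_rpow_const h.α_pos.le (q := P.α)).continuousAt (x := P.M₁)
    exact continuousAt_const.mul (continuousAt_const.div (continuousAt_const.add this)
      (one_pos.trans_le (one_le_one_add_rpow h.M₁_nonneg)).ne')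
  -- The upper overshoot `ε₁` is chosen so small that it costs at most `ε / 2` in the lower bound;
  -- the two transients in `mild_lower` take `ε / 4` each.
  obtain ⟨ε₁, hε₁, hε₁'⟩ : ∃ ε₁, 0 < ε₁ ∧ ε₁ ≤ ε ∧ φ P.M₁ - ε / 2 ≤ φ (P.M₁ + ε₁) := by
    obtain ⟨d, hd, hd'⟩ := Metric.continuousAt_iff.1 hφc (ε / 2) (half_pos hε)
    refine ⟨min (d / 2) ε, lt_min (half_pos hd) hε, min_le_right _ _, ?_⟩
    have h1 : 0 < min (d / 2) ε := lt_min (half_pos hd) hε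
    have h2 := @hd' (P.M₁ + min (d / 2) ε) (by
      rw [Real.dist_eq, add_sub_cancel_left, abs_of_pos h1]
      exact (min_le_left _ _).trans_lt (half_lt_self hd))
    rw [Real.dist_eq, abs_lt] at h2
    linarith [h2.1]
  have hφ0 : 0 ≤ φ (P.M₁ + ε₁) := mul_nonneg (div_nonneg h.B_pos.le h.aM_pos.le)
    (div_nonneg h.bL_nonneg (one_pos.le.trans
      (one_le_one_add_rpow (add_nonneg h.M₁_nonneg hε₁.le))))
  obtain ⟨T₁, hT₁, hT₁'⟩ := exists_mul_exp_neg_le h.aL_pos (P.A * (|R| + S)) hε₁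
  obtain ⟨T₂, hT₂, hT₂'⟩ := exists_mul_exp_neg_le h.aM_pos (φ (P.M₁ + ε₁))
    (show 0 < ε / 4 by positivity)
  obtain ⟨T₃, hT₃, hT₃'⟩ := exists_mul_exp_neg_le h.aL_pos (P.A * S)
    (show 0 < ε / 4 by positivity)
  refine ⟨T₁ + P.τ + T₂ + T₃, by positivity, fun t₀ y hy hR s hs => ?_⟩
  have hup : ∀ u, t₀ + T₁ ≤ u → y u ≤ P.M₁ + ε₁ := by
    intro u hu
    refine (h.mild_upper hy hS (by linarith)).trans (add_le_add_right ?_ _)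
    refine le_trans ?_ (hT₁' (u - t₀) (by linarith))
    have := hR.trans (le_abs_self R)
    calc P.A * Real.exp (-P.aL * (u - t₀)) * (y t₀ + S)
        ≤ P.A * Real.exp (-P.aL * (u - t₀)) * (|R| + S) := by gcongr
      _ = _ := by ring
  -- The restart is delayed by `τ` so that the delayed arguments also lie after `t₀ + T₁`.
  have hlow := h.mild_lower (hy.mono (show t₀ ≤ t₀ + T₁ + P.τ by linarith)) hS
    (fun u hu => hup u (by linarith)) (s := s) (by linarith)
  have h2 := hT₂' (s - (t₀ + T₁ + P.τ)) (by linarith)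
  have h3 := hT₃' (s - (t₀ + T₁ + P.τ)) (by linarith)
  have h4 := hup s (by linarith)
  simp only [hφ] at h2 hε₁'
  rw [M₂_eq]
  constructor <;> linarith

lemma mild_diff_bound {t₀ S r : ℝ} {x y : ℝ → ℝ} (hxI : ∀ s, x s ∈ Icc P.M₂ P.M₁)
    (hM₂ : 0 < P.M₂) (hy : P.IsMild t₀ y) (hS : ∀ s, |P.jumpResponse s| ≤ S)
    (hr : ∀ s ∈ Icc (t₀ - P.τ) t₀, |y s - x s| ≤ r) {s : ℝ} (hs : t₀ ≤ s) :
    |y s - x s| ≤ P.M₁ + P.A * Real.exp (-P.aL * (s - t₀)) * (P.M₁ + r + S) := by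
  have hτ := h.τ_nonneg
  have h1 := h.mild_upper hy hS hs
  have h2 := (abs_le.1 (hr t₀ ⟨by linarith, le_rfl⟩)).2
  have h3 : y t₀ + S ≤ P.M₁ + r + S := by linarith [(hxI t₀).2]
  have hA := A_pos (P := P)
  have h4 : P.A * Real.exp (-P.aL * (s - t₀)) * (y t₀ + S) ≤
      P.A * Real.exp (-P.aL * (s - t₀)) * (P.M₁ + r + S) := by gcongr
  have h5 : 0 ≤ P.A * Real.exp (-P.aL * (s - t₀)) * (P.M₁ + r + S) := by
    have := hy.nonneg t₀ (by linarith)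
    have := (abs_nonneg _).trans (hS t₀)
    refine mul_nonneg (by positivity) (by linarith)
  have h6 := hy.nonneg s (by linarith)
  have h7 := hxI s
  rw [abs_le]
  constructor <;> linarith [h7.1, h7.2]

/-- At `ε = c = 0` the expression is the contraction constant. The closed form of `lip` is
continuous in its endpoints, so one small number can serve both as `ε` and as `c`. -/
lemma exists_lip_margin (hM₂ : 0 < P.M₂) (hM : 0 < P.M₁)
    (hθ : P.A * P.bM * P.lip P.M₂ P.M₁ / P.aL < 1) :
    ∃ ε c : ℝ, 0 < ε ∧ ε < P.M₂ ∧ 0 < c ∧ c < P.aL ∧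
      P.A * P.bM * P.lip (P.M₂ - ε) (P.M₁ + ε) * Real.exp (c * P.τ) / (P.aL - c) < 1 := by
  have h1 : ContinuousAt (fun ε : ℝ => P.A * P.bM * P.lip (P.M₂ - ε) (P.M₁ + ε) *
      Real.exp (ε * P.τ) / (P.aL - ε)) 0 := by
    have e1 : ContinuousAt (fun ε : ℝ => P.lip (P.M₂ - ε) (P.M₁ + ε)) 0 := by
      unfold lip
      refine continuousAt_const.mul (Tendsto.max ?_ ?_)
      · exact (ContinuousAt.sub continuousAt_const continuousAt_id).rpow_const
          (Or.inl (by simpa using hM₂.ne'))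
      · exact (ContinuousAt.add continuousAt_const continuousAt_id).rpow_const
          (Or.inl (by simpa using hM.ne'))
    exact ((continuousAt_const.mul e1).mul (by fun_prop)).div (by fun_prop)
      (by simpa using h.aL_pos.ne')
  have h2 := h1.eventually_lt_const (u := 1) (by simpa using hθ)
  obtain ⟨ε, ⟨h3, h4, h5⟩, h6⟩ := (((h2.and ((eventually_lt_nhds hM₂).and
    (eventually_lt_nhds h.aL_pos))).filter_mono
      (nhdsWithin_le_nhds (s := Ioi 0))).and self_mem_nhdsWithin).exists
  exact ⟨ε, ε, h6, h4, h6, h5, h3⟩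

/-- The rate `c` is chosen before the bound `R` on the initial deviation; only the constant `C`
depends on `R`, through the absorption time. -/
lemma exists_decay_of_bounded {x : ℝ → ℝ} (hx : ∀ t₀, P.IsMild t₀ x)
    (hxI : ∀ s, x s ∈ Icc P.M₂ P.M₁) (hM₂ : 0 < P.M₂)
    (hθ : P.A * P.bM * P.lip P.M₂ P.M₁ / P.aL < 1) :
    ∃ c, 0 < c ∧ c < P.aL ∧ ∀ R, ∃ C, 0 ≤ C ∧ ∀ t₀ y r, P.IsMild t₀ y → r ≤ R →
      (∀ s ∈ Icc (t₀ - P.τ) t₀, |y s - x s| ≤ r) →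
      ∀ s, t₀ ≤ s → |y s - x s| ≤ C * r * Real.exp (-c * (s - t₀)) := by
  have hM : 0 < P.M₁ := hM₂.trans_le ((hxI 0).1.trans (hxI 0).2)
  have hτ := h.τ_nonneg
  have hA := A_pos (P := P)
  have hbM := h.bM_nonneg
  have haL := h.aL_pos
  obtain ⟨ε, c, hε, hεM, hc, hca, hθ'⟩ := h.exists_lip_margin hM₂ hM hθ
  obtain ⟨L, hL0, hL⟩ := h.exists_hill_lip_global hM₂
  obtain ⟨S, hS0, hS⟩ := h.exists_jumpResponse_bound
  refine ⟨c, hc, hca, fun R => ?_⟩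
  obtain ⟨T, hT0, hT⟩ := h.exists_absorption hε (P.M₁ + R)
  -- Growth at rate `m` is allowed before absorption: with `c = -m` the constant in `mild_diff_le`
  -- is at most `m / (aL + m) < 1`, however large `L` is.
  set m := P.A * P.bM * L
  have hm0 : 0 ≤ m := by positivity
  have hθ₁ : P.A * P.bM * L * Real.exp (-m * P.τ) / (P.aL - -m) < 1 := by
    rw [div_lt_one (by linarith)]
    have : Real.exp (-m * P.τ) ≤ 1 := Real.exp_le_one_iff.2 (by nlinarith)
    calc m * Real.exp (-m * P.τ) ≤ m := mul_le_of_le_one_right hm0 this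
      _ < P.aL - -m := by linarith
  set C₁ := (P.A + Real.exp (|-m| * P.τ)) /
    (1 - P.A * P.bM * L * Real.exp (-m * P.τ) / (P.aL - -m))
  set C₂ := (P.A + Real.exp (|c| * P.τ)) /
    (1 - P.A * P.bM * P.lip (P.M₂ - ε) (P.M₁ + ε) * Real.exp (c * P.τ) / (P.aL - c))
  have hC₁ : 0 ≤ C₁ := div_nonneg (by positivity) (sub_pos.2 hθ₁).le
  have hC₂ : 0 ≤ C₂ := div_nonneg (by positivity) (sub_pos.2 hθ').le
  set D := (C₁ + 1) * Real.exp (m * (T + P.τ)) with hD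
  have hD0 : 0 ≤ D := by positivity
  have hE : 1 ≤ Real.exp (m * (T + P.τ)) := Real.one_le_exp (by positivity)
  refine ⟨(1 + C₂) * D * Real.exp (c * (T + P.τ)), by positivity, fun t₀ y r hy hrR hr s hs => ?_⟩
  have hr0 : 0 ≤ r := (abs_nonneg _).trans (hr t₀ ⟨by linarith, le_rfl⟩)
  have hbound : ∀ u, t₀ - P.τ ≤ u → |y u - x u| ≤ r + (P.M₁ + P.A * (P.M₁ + r + S)) := by
    intro u hu
    have h0 : 0 ≤ P.A * (P.M₁ + r + S) := by positivity
    rcases le_or_gt u t₀ with hut | hut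
    · linarith [hr u ⟨hu, hut⟩]
    · have h1 := h.mild_diff_bound hxI hM₂ hy hS hr hut.le
      have h2 : Real.exp (-P.aL * (u - t₀)) ≤ 1 := Real.exp_le_one_iff.2 (by nlinarith)
      have h3 : P.A * Real.exp (-P.aL * (u - t₀)) * (P.M₁ + r + S) ≤ P.A * (P.M₁ + r + S) := by
        rw [mul_right_comm]; exact mul_le_of_le_one_right h0 h2
      linarith
  have hgrow : ∀ u ∈ Icc (t₀ - P.τ) (t₀ + T + P.τ), |y u - x u| ≤ D * r := by
    intro u hu
    rcases le_or_gt u t₀ with hut | hut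
    · have h1 : 1 ≤ D := by rw [hD]; nlinarith
      exact (hr u ⟨hu.1, hut⟩).trans (le_mul_of_one_le_left hr0 h1)
    · have h1 := h.mild_diff_le (hx t₀) hy hL0
        (fun w hw => hL _ _ (hy.nonneg w hw) (hxI w).1) hbound hr
        (show -m < P.aL by linarith) hθ₁ hut.le
      refine h1.trans ?_
      have h2 : Real.exp (- -m * (u - t₀)) ≤ Real.exp (m * (T + P.τ)) := by
        rw [neg_neg]
        exact Real.exp_le_exp.2 (mul_le_mul_of_nonneg_left (by linarith [hu.2]) hm0)
      calc C₁ * r * Real.exp (- -m * (u - t₀)) ≤ (C₁ + 1) * r * Real.exp (m * (T + P.τ)) := by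
            gcongr; linarith
        _ = D * r := by rw [hD]; ring
  have hyR : y t₀ ≤ P.M₁ + R := by
    have := (abs_le.1 (hr t₀ ⟨by linarith, le_rfl⟩)).2
    linarith [(hxI t₀).2]
  rcases le_or_gt s (t₀ + T + P.τ) with hsT | hsT
  · have h1 : 1 ≤ Real.exp (c * (T + P.τ)) * Real.exp (-c * (s - t₀)) := by
      rw [← Real.exp_add, Real.one_le_exp_iff]
      nlinarith
    calc |y s - x s| ≤ D * r := hgrow s ⟨by linarith, hsT⟩
      _ ≤ (1 + C₂) * (D * r) := le_mul_of_one_le_left (by positivity) (by linarith)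
      _ ≤ (1 + C₂) * (D * r) * (Real.exp (c * (T + P.τ)) * Real.exp (-c * (s - t₀))) :=
          le_mul_of_one_le_right (by positivity) h1
      _ = _ := by ring
  -- The whole history interval `[t₁ - τ, t₁]` lies in the absorbed regime, and the growth bound `D
  -- * r` serves as the new initial deviation.
  · set t₁ := t₀ + T + P.τ
    have hIcc : ∀ u, t₁ - P.τ ≤ u → y u ∈ Icc (P.M₂ - ε) (P.M₁ + ε) := fun u hu =>
      hT t₀ y hy hyR u (by simp only [t₁] at hu; linarith)
    have hxIcc : ∀ u, x u ∈ Icc (P.M₂ - ε) (P.M₁ + ε) := fun u =>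
      ⟨by linarith [(hxI u).1], by linarith [(hxI u).2]⟩
    have h01 : t₀ ≤ t₁ := by simp only [t₁]; linarith
    have h1 := h.mild_diff_le (hx t₁) (hy.mono h01) (h.lip_nonneg (sub_pos.2 hεM))
      (fun w hw => h.hill_lip (sub_pos.2 hεM) (hIcc w hw) (hxIcc w))
      (fun w hw => hbound w (by linarith)) (fun w hw => hgrow w ⟨by linarith [hw.1], hw.2⟩)
      hca hθ' hsT.le
    refine h1.trans ?_
    have e : Real.exp (-c * (s - t₁)) = Real.exp (c * (T + P.τ)) * Real.exp (-c * (s - t₀)) := by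
      rw [← Real.exp_add]; congr 1; simp only [t₁]; ring
    rw [e]
    calc C₂ * (D * r) * (Real.exp (c * (T + P.τ)) * Real.exp (-c * (s - t₀)))
        ≤ (1 + C₂) * (D * r) * (Real.exp (c * (T + P.τ)) * Real.exp (-c * (s - t₀))) := by
          gcongr; linarith
      _ = _ := by ring

/-- The remaining issue is to make the constant independent of `r`. For `r > R`, the linear part
brings the deviation below `R` within time about `log r / aL`; since `c < aL`, this delay costs a
factor of at most `r`, which the claimed bound contains. -/
lemma isExpStable {x : ℝ → ℝ} (hx : ∀ t₀, P.IsMild t₀ x)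
    (hxI : ∀ s, x s ∈ Icc P.M₂ P.M₁) (hM₂ : 0 < P.M₂)
    (hθ : P.A * P.bM * P.lip P.M₂ P.M₁ / P.aL < 1) : P.IsExpStable x := by
  obtain ⟨c, hc, hca, hdecay⟩ := h.exists_decay_of_bounded hx hxI hM₂ hθ
  obtain ⟨S, hS0, hS⟩ := h.exists_jumpResponse_bound
  have hτ := h.τ_nonneg
  have hA := A_pos (P := P)
  have haL := h.aL_pos
  have hM := h.M₁_nonneg
  set C₃ := P.A * (P.M₁ + 1 + S)
  have hC₃ : 0 ≤ C₃ := by positivity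
  set R := max 1 (P.M₁ + C₃)
  have hR1 : 1 ≤ R := le_max_left _ _
  obtain ⟨C, hC, hdec⟩ := hdecay R
  set E := Real.exp (c * P.τ)
  have hE : 0 < E := Real.exp_pos _
  refine ⟨C + C * R * E + P.M₁ * E + C₃ + 1, c, by positivity, hc,
    fun t₀ y hy' r hr s hs => ?_⟩
  have hy := h.isMild hy'
  have hr0 : 0 ≤ r := (abs_nonneg _).trans (hr t₀ ⟨by linarith, le_rfl⟩)
  rcases le_or_gt r R with hrR | hrR
  · refine (hdec t₀ y r hy hrR hr s hs).trans ?_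
    gcongr
    have : 0 ≤ C * R * E + P.M₁ * E + C₃ + 1 := by positivity
    linarith
  · have hr1 : 1 ≤ r := hR1.trans hrR.le
    set T := Real.log r / P.aL
    have hT0 : 0 ≤ T := div_nonneg (Real.log_nonneg hr1) haL.le
    have hTr : Real.exp (P.aL * T) = r := by
      rw [mul_div_cancel₀ _ haL.ne', Real.exp_log (by linarith)]
    have hcT : Real.exp (c * T) ≤ r := by
      rw [← hTr]; gcongr
    have hz : ∀ u, t₀ ≤ u → |y u - x u| ≤ P.M₁ + C₃ * (r * Real.exp (-P.aL * (u - t₀))) := by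
      intro u hu
      refine (h.mild_diff_bound hxI hM₂ hy hS hr hu).trans (add_le_add_right ?_ _)
      -- This uses `1 ≤ r`.
      have h1 : P.M₁ + r + S ≤ (P.M₁ + 1 + S) * r := by nlinarith
      calc _ ≤ P.A * Real.exp (-P.aL * (u - t₀)) * ((P.M₁ + 1 + S) * r) := by gcongr
        _ = _ := by simp only [C₃]; ring
    rcases le_or_gt s (t₀ + T + P.τ) with hsT | hsT
    · have h1 : 1 ≤ E * (r * Real.exp (-c * (s - t₀))) := by
        calc (1 : ℝ) ≤ E * (Real.exp (c * T) * Real.exp (-c * (s - t₀))) := by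
              rw [← Real.exp_add, ← Real.exp_add, Real.one_le_exp_iff]
              nlinarith
          _ ≤ _ := by gcongr
      have h2 : Real.exp (-P.aL * (s - t₀)) ≤ Real.exp (-c * (s - t₀)) :=
        Real.exp_le_exp.2 (by nlinarith)
      calc |y s - x s| ≤ P.M₁ + C₃ * (r * Real.exp (-P.aL * (s - t₀))) := hz s hs
        _ ≤ P.M₁ * (E * (r * Real.exp (-c * (s - t₀)))) +
            C₃ * (r * Real.exp (-c * (s - t₀))) := by
            gcongr
            exact le_mul_of_one_le_right hM h1
        _ = (P.M₁ * E + C₃) * r * Real.exp (-c * (s - t₀)) := by ring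
        _ ≤ _ := by
            have : 0 ≤ C + C * R * E := by positivity
            exact mul_le_mul_of_nonneg_right (mul_le_mul_of_nonneg_right (by linarith) hr0)
              (Real.exp_pos _).le
    · have hR' : ∀ u ∈ Icc (t₀ + T + P.τ - P.τ) (t₀ + T + P.τ), |y u - x u| ≤ R := by
        intro u hu
        refine (hz u (by linarith [hu.1])).trans (le_trans ?_ (le_max_right _ _))
        refine add_le_add_right (mul_le_of_le_one_right hC₃ ?_) _
        rw [← hTr, ← Real.exp_add, Real.exp_le_one_iff]
        nlinarith [hu.1]
      refine (hdec _ y R (hy.mono (by linarith)) le_rfl hR' s hsT.le).trans ?_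
      have e : Real.exp (-c * (s - (t₀ + T + P.τ))) =
          E * (Real.exp (c * T) * Real.exp (-c * (s - t₀))) := by
        rw [← Real.exp_add, ← Real.exp_add]; congr 1; ring
      rw [e]
      calc C * R * (E * (Real.exp (c * T) * Real.exp (-c * (s - t₀))))
          ≤ C * R * (E * (r * Real.exp (-c * (s - t₀)))) := by gcongr
        _ = C * R * E * r * Real.exp (-c * (s - t₀)) := by ring
        _ ≤ _ := by
            gcongr
            have : 0 ≤ P.M₁ * E := by positivity
            linarith

end Admissible
end HematopoiesisModel

/-! ### The effect of a common almost period on the fixed point. -/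

lemma abs_exp_sub_exp_le {u v M : ℝ} (hu : Real.exp u ≤ M) (hv : Real.exp v ≤ M) :
    |Real.exp u - Real.exp v| ≤ M * |u - v| := by
  have key : ∀ u v : ℝ, Real.exp u ≤ M → Real.exp u - Real.exp v ≤ M * |u - v| := by
    intro u v hu
    have h1 := Real.add_one_le_exp (v - u)
    have h2 : Real.exp v = Real.exp u * Real.exp (v - u) := by rw [← Real.exp_add]; congr 1; ring
    have h3 := Real.exp_pos u
    calc Real.exp u - Real.exp v ≤ Real.exp u * (u - v) := by rw [h2]; nlinarith
      _ ≤ Real.exp u * |u - v| := by gcongr; exact le_abs_self _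
      _ ≤ M * |u - v| := by gcongr
  rw [abs_le]
  have h1 := key u v hu
  have h2 := key v u hv
  rw [abs_sub_comm] at h2
  constructor <;> linarith

/-- The shift error of `logFund` grows linearly with elapsed time; half of the decay rate is spent
on absorbing this growth. -/
lemma mul_exp_neg_le {c v : ℝ} (hc : 0 < c) :
    v * Real.exp (-c * v) ≤ 2 / c * Real.exp (-(c / 2) * v) := by
  have h1 := Real.add_one_le_exp (c / 2 * v)
  have h2 : Real.exp (-c * v) = Real.exp (-(c / 2) * v) * Real.exp (-(c / 2 * v)) := by
    rw [← Real.exp_add]; congr 1; ring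
  have h3 : v * Real.exp (-(c / 2 * v)) ≤ 2 / c := by
    have : v ≤ 2 / c * Real.exp (c / 2 * v) := by
      calc v = 2 / c * (c / 2 * v) := by field_simp
        _ ≤ _ := by gcongr; linarith
    rw [Real.exp_neg]
    exact (mul_inv_le_iff₀ (Real.exp_pos _)).2 this
  calc v * Real.exp (-c * v) = (v * Real.exp (-(c / 2 * v))) * Real.exp (-(c / 2) * v) := by
        rw [h2]; ring
    _ ≤ _ := by gcongr

lemma setIntegral_Iic_comp_add_right (f : ℝ → ℝ) (s w : ℝ) :
    ∫ r in Iic s, f (r + w) = ∫ r in Iic (s + w), f r := by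
  rw [← MeasureTheory.integral_indicator measurableSet_Iic,
    ← MeasureTheory.integral_indicator measurableSet_Iic,
    ← MeasureTheory.integral_add_right_eq_self ((Iic (s + w)).indicator f) w]
  congr 1
  ext r
  simp [indicator]

lemma integrableOn_Iic_comp_add_right {f : ℝ → ℝ} {s w : ℝ}
    (hf : MeasureTheory.IntegrableOn f (Iic (s + w))) :
    MeasureTheory.IntegrableOn (fun r => f (r + w)) (Iic s) := by
  rw [← MeasureTheory.integrable_indicator_iff measurableSet_Iic] at hf ⊢
  refine (hf.comp_add_right w).congr (MeasureTheory.ae_of_all _ fun r => ?_)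
  simp [indicator]

/-- Closed `ε`-neighbourhood of the set of instants. -/
def nearInstants (t : ℤ → ℝ) (ε : ℝ) : Set ℝ := {r | ∃ k, |r - t k| ≤ ε}

lemma measurableSet_nearInstants (t : ℤ → ℝ) (ε : ℝ) : MeasurableSet (nearInstants t ε) := by
  have : nearInstants t ε = ⋃ k, {r | |r - t k| ≤ ε} := by ext; simp [nearInstants]
  rw [this]
  exact MeasurableSet.iUnion fun k => measurableSet_le (by fun_prop) measurable_const

lemma notMem_nearInstants {t : ℤ → ℝ} {ε r : ℝ} :
    r ∉ nearInstants t ε ↔ ∀ k, ε < |r - t k| := by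
  simp [nearInstants]

namespace HematopoiesisModel

variable {P : HematopoiesisModel}

/-- Exponential weight restricted to the neighbourhood of the instants. -/
def nearWeight (P : HematopoiesisModel) (ε s r : ℝ) : ℝ :=
  (nearInstants P.t ε).indicator (fun r => Real.exp (-P.aL * (s - r))) r

/-- Common almost periods of the data of the model. -/
abbrev IsPeriod (P : HematopoiesisModel) (ε w : ℝ) (q : ℤ) : Prop :=
  CommonPeriod P.t P.a P.b (fun k => Real.log (1 + P.γ k)) P.δ ε w q

namespace Admissible

variable (h : P.Admissible)
include h

lemma integrableOn_nearWeight (ε s : ℝ) :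
    MeasureTheory.IntegrableOn (P.nearWeight ε s) (Iic s) :=
  (integrableOn_exp_neg_mul_sub h.aL_pos s).indicator (measurableSet_nearInstants _ _)

-- Each instant contributes an interval of length `2 ε`, and the weights decay geometrically along
-- past instants. Extended nonnegative integrals give countable subadditivity over these intervals.
open MeasureTheory in
lemma integral_nearWeight_le {ε : ℝ} (hε : 0 < ε) (hεη : ε < P.η) (s : ℝ) :
    ∫ r in Iic s, P.nearWeight ε s r ≤
      2 * ε * Real.exp (P.aL * (P.ηbar + ε)) / (1 - Real.exp (-P.aL * P.η)) := by
  set n := P.idx s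
  set ρ := Real.exp (-P.aL * P.η)
  set E := Real.exp (P.aL * (P.ηbar + ε))
  have hρ : 0 < 1 - ρ := sub_pos.2 h.ratio_lt_one
  obtain ⟨hn1, hn2⟩ := h.idx_spec s
  have hnn : ∀ r, 0 ≤ P.nearWeight ε s r := fun r =>
    indicator_nonneg (fun _ _ => (Real.exp_pos _).le) r
  have hrhs : 0 ≤ 2 * ε * E / (1 - ρ) := by positivity
  rw [← ENNReal.ofReal_le_ofReal_iff hrhs, ofReal_integral_eq_lintegral_ofReal
    (h.integrableOn_nearWeight ε s) (ae_of_all _ hnn)]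
  let U : ℕ → Set ℝ := fun j => Icc (P.t (n - j) - ε) (P.t (n - j) + ε)
  have hcover : Iic s ∩ nearInstants P.t ε ⊆ ⋃ j, U j := by
    rintro r ⟨hr, k, hk⟩
    -- Since `ε < η`, instants after `t n` are more than `ε` above `s`. The instant `t n` itself may
    -- lie after `s` and still have to be counted.
    have hkn : k ≤ n := by
      by_contra hc
      have h1 := h.t_strictMono.monotone (show n + 1 ≤ k by omega)
      have h2 := h.η_le n
      have h3 := (abs_le.1 hk).1
      rw [mem_Iic] at hr
      linarith
    refine mem_iUnion.2 ⟨(n - k).toNat, ?_⟩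
    have e : n - ((n - k).toNat : ℤ) = k := by omega
    simp only [U, e]
    constructor <;> linarith [(abs_le.1 hk).1, (abs_le.1 hk).2]
  have hexp : ∀ j, ∀ r ∈ U j, Real.exp (-P.aL * (s - r)) ≤ E * ρ ^ j := by
    intro j r hr
    rw [← Real.exp_nat_mul, ← Real.exp_add]
    refine Real.exp_le_exp.2 ?_
    have h1 : (j : ℝ) * P.η - (P.ηbar + ε) ≤ s - r := by
      have h2 := h.le_ηbar (n - 1)
      rw [sub_add_cancel] at h2
      have h3 := h.gap_ge (show n - (j : ℤ) ≤ n by omega)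
      push_cast at h3
      linarith [hr.2]
    have := mul_le_mul_of_nonneg_left h1 h.aL_pos.le
    linarith
  calc ∫⁻ r in Iic s, ENNReal.ofReal (P.nearWeight ε s r)
      = ∫⁻ r in Iic s ∩ nearInstants P.t ε, ENNReal.ofReal (Real.exp (-P.aL * (s - r))) := by
        rw [inter_comm, ← Measure.restrict_restrict (measurableSet_nearInstants _ _),
          ← lintegral_indicator (measurableSet_nearInstants _ _)]
        congr 1
        ext r
        by_cases hr : r ∈ nearInstants P.t ε <;> simp [nearWeight, hr]
    _ ≤ ∫⁻ r in ⋃ j, U j, ENNReal.ofReal (Real.exp (-P.aL * (s - r))) :=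
        lintegral_mono_set hcover
    _ ≤ ∑' j, ∫⁻ r in U j, ENNReal.ofReal (Real.exp (-P.aL * (s - r))) := lintegral_iUnion_le _ _
    _ ≤ ∑' j : ℕ, ENNReal.ofReal (2 * ε * E * ρ ^ j) := by
        refine ENNReal.tsum_le_tsum fun j => ?_
        calc _ ≤ ∫⁻ _ in U j, ENNReal.ofReal (E * ρ ^ j) :=
              setLIntegral_mono' measurableSet_Icc fun r hr =>
                ENNReal.ofReal_le_ofReal (hexp j r hr)
          _ = _ := by
              rw [setLIntegral_const, Real.volume_Icc, ← ENNReal.ofReal_mul (by positivity)]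
              congr 1
              ring
    _ = ENNReal.ofReal (2 * ε * E / (1 - ρ)) := by
        have hs : HasSum (fun j : ℕ => 2 * ε * E * ρ ^ j) (2 * ε * E / (1 - ρ)) :=
          (hasSum_geometric_of_lt_one (Real.exp_pos _).le h.ratio_lt_one).mul_left _
        rw [← hs.tsum_eq, ENNReal.ofReal_tsum_of_nonneg (fun j => by positivity) hs.summable]

lemma idx_shift {ε w : ℝ} {q : ℤ} (hp : P.IsPeriod ε w q) {s : ℝ}
    (hs : s ∉ nearInstants P.t ε) : P.idx (s + w) = P.idx s + q := by
  rw [notMem_nearInstants] at hs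
  obtain ⟨h1, h2⟩ := h.idx_spec s
  have h3 := hs (P.idx s - 1)
  have h4 := hs (P.idx s)
  rw [abs_of_pos (by linarith)] at h3
  rw [abs_of_nonpos (by linarith)] at h4
  have h5 := abs_lt.1 (hp.inst (P.idx s - 1))
  have h6 := abs_lt.1 (hp.inst (P.idx s))
  rw [show P.idx s - 1 + q = P.idx s + q - 1 by ring] at h5
  exact h.idx_eq (by linarith [h5.2]) (by linarith [h6.1])

omit h in
lemma abs_lg_shift_le {ε w : ℝ} {q : ℤ} (hp : P.IsPeriod ε w q) {m n : ℤ} (hmn : m ≤ n) :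
    |(P.lg (n + q) - P.lg (m + q)) - (P.lg n - P.lg m)| ≤ ε * ((n : ℝ) - m) := by
  induction n, hmn using Int.leInduction with
  | base => simp
  | succ n hmn ih =>
    have h1 := (hp.seq_fst n).le
    rw [show n + 1 + q = n + q + 1 by ring, lg_succ, lg_succ]
    push_cast
    rw [abs_le] at *
    constructor <;> linarith [h1.1, h1.2, ih.1, ih.2]

lemma abs_int_a_shift_le {ε w : ℝ} {q : ℤ} (hp : P.IsPeriod ε w q) {r s : ℝ} (hrs : r ≤ s) :
    |(∫ u in (r + w)..(s + w), P.a u) - ∫ u in r..s, P.a u| ≤ ε * (s - r) := by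
  have hc : Continuous fun u => P.a (u + w) := h.a_ap.1.comp (continuous_id.add continuous_const)
  rw [← intervalIntegral.integral_comp_add_right (fun u => P.a u),
    ← intervalIntegral.integral_sub (hc.intervalIntegrable _ _) (h.a_intervalIntegrable _ _),
    ← Real.norm_eq_abs]
  refine (intervalIntegral.norm_integral_le_of_norm_le_const (C := ε) fun u _ =>
    (hp.fst u).le).trans_eq ?_
  rw [abs_of_nonneg (sub_nonneg.2 hrs)]

/-- The factors `1 + γ` crossed between `r` and `s` number at most `(s - r) / η + 1`. Each
contributes an error `ε`, and the integral of `a` contributes `ε * (s - r)`. -/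
lemma abs_logFund_shift_le {ε w : ℝ} {q : ℤ} (hε : 0 < ε) (hp : P.IsPeriod ε w q) {r s : ℝ}
    (hrs : r ≤ s) (hr : r ∉ nearInstants P.t ε) (hs : s ∉ nearInstants P.t ε) :
    |(P.logFund (s + w) - P.logFund (r + w)) - (P.logFund s - P.logFund r)| ≤
      ε * (1 + (1 + 1 / P.η) * (s - r)) := by
  have hmono := h.idx_mono hrs
  have h1 := abs_lg_shift_le hp hmono
  have h2 := h.abs_int_a_shift_le hp hrs
  rw [← h.int_a_sub (r + w), ← h.int_a_sub r s] at h2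
  have h3 : (P.idx s : ℝ) - P.idx r ≤ (s - r) / P.η + 1 := by
    rcases hmono.eq_or_lt with he | hlt
    · rw [he, sub_self]
      have := div_nonneg (sub_nonneg.2 hrs) h.η_pos.le
      linarith
    · have h4 := h.gap_ge (show P.idx r ≤ P.idx s - 1 by omega)
      have h5 := (h.idx_spec s).1
      have h6 := (h.idx_spec r).2
      push_cast at h4
      have : (P.idx s : ℝ) - P.idx r - 1 ≤ (s - r) / P.η := by
        rw [le_div_iff₀ h.η_pos]
        linarith
      linarith
  have h7 := mul_le_mul_of_nonneg_left h3 hε.le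
  have e : ε * (1 + (1 + 1 / P.η) * (s - r)) = ε * ((s - r) / P.η + 1) + ε * (s - r) := by ring
  rw [e]
  unfold logFund
  rw [h.idx_shift hp hr, h.idx_shift hp hs]
  rw [abs_le] at *
  constructor <;> linarith [h1.1, h1.2, h2.1, h2.2]

lemma exists_jumpResponse_shift_bound : ∃ C, 0 ≤ C ∧ ∀ ε w q, 0 < ε → P.IsPeriod ε w q →
    ∀ s, s ∉ nearInstants P.t ε → |P.jumpResponse (s + w) - P.jumpResponse s| ≤ C * ε := by
  obtain ⟨Δ, hΔ0, hΔ⟩ := h.exists_δ_bound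
  set ρ := Real.exp (-P.aL * P.η) with hρ
  have hρ0 : 0 < ρ := Real.exp_pos _
  have hA := A_pos (P := P)
  have hη := h.ηbar_pos
  have haM := h.aM_pos
  have hsum : Summable fun j : ℕ =>
      P.A * Δ * (1 + P.ηbar) * ((j : ℝ) * ρ ^ j) + P.A * (Δ * (P.ηbar + P.aM) + 1) * ρ ^ j := by
    refine Summable.add (Summable.mul_left _ ?_) (h.summable_geom.mul_left _)
    have := summable_pow_mul_geometric_of_norm_lt_one (R := ℝ) 1 (r := ρ)
      (by rw [Real.norm_of_nonneg hρ0.le]; exact h.ratio_lt_one)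
    simpa using this
  refine ⟨∑' j : ℕ, (P.A * Δ * (1 + P.ηbar) * ((j : ℝ) * ρ ^ j) +
      P.A * (Δ * (P.ηbar + P.aM) + 1) * ρ ^ j), tsum_nonneg fun j => by positivity,
    fun ε w q hε hp s hs => ?_⟩
  have hidx := h.idx_shift hp hs
  unfold jumpResponse
  rw [← (h.summable_jumpResponse _).tsum_sub (h.summable_jumpResponse _), ← tsum_mul_right,
    ← Real.norm_eq_abs]
  refine tsum_of_norm_bounded (hsum.mul_right ε).hasSum fun j => ?_
  have hb1 := h.weightRight_idx_le (s + w) j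
  have hb2 := h.weightRight_idx_le s j
  obtain ⟨h1, h2, h3⟩ := h.idx_sub_spec s j
  rw [hidx, show P.idx s + q - 1 - (j : ℤ) = P.idx s - 1 - j + q by ring] at hb1 ⊢
  set k := P.idx s - 1 - (j : ℤ)
  have hlog : |(P.logFund (s + w) - P.logFundRight (k + q)) - (P.logFund s - P.logFundRight k)| ≤
      ε * (j + (j + 1) * P.ηbar + P.aM) := by
    have e1 := abs_lg_shift_le hp (show k + 1 ≤ P.idx s by omega)
    have e2 := h.abs_int_a_shift_le hp h1.le
    rw [← h.int_a_sub (P.t k + w), ← h.int_a_sub (P.t k) s] at e2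
    -- The instant `t (k + q)` is only within `ε` of `t k + w`; the mismatch costs at most `aM * ε`.
    have e3 : |(∫ u in (0 : ℝ)..P.t (k + q), P.a u) - ∫ u in (0 : ℝ)..(P.t k + w), P.a u| ≤
        P.aM * ε := by
      rw [h.int_a_sub, ← Real.norm_eq_abs]
      refine (intervalIntegral.norm_integral_le_of_norm_le_const (C := P.aM) fun u _ => ?_).trans ?_
      · rw [Real.norm_of_nonneg (h.aL_pos.le.trans (h.aL_le u))]
        exact h.le_aM u
      · refine mul_le_mul_of_nonneg_left ?_ haM.le
        rw [show P.t (k + q) - (P.t k + w) = P.t (k + q) - P.t k - w by ring]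
        exact (hp.inst k).le
    have e4 : ((P.idx s : ℤ) : ℝ) - ((k + 1 : ℤ) : ℝ) = j := by simp only [k]; push_cast; ring
    rw [e4] at e1
    have e5 := mul_le_mul_of_nonneg_left h3 hε.le
    rw [show k + 1 + q = k + q + 1 by ring] at e1
    unfold logFund logFundRight
    rw [hidx]
    rw [abs_le] at *
    constructor <;> linarith [e1.1, e1.2, e2.1, e2.2, e3.1, e3.2]
  have hexp := abs_exp_sub_exp_le hb1 hb2
  have hδ1 := (hp.seq_snd k).le
  rw [Real.norm_eq_abs]
  calc _ = |(Real.exp (P.logFund (s + w) - P.logFundRight (k + q)) -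
          Real.exp (P.logFund s - P.logFundRight k)) * P.δ (k + q) +
          Real.exp (P.logFund s - P.logFundRight k) * (P.δ (k + q) - P.δ k)| := by
        congr 1; ring
    _ ≤ (P.A * ρ ^ j * (ε * (j + (j + 1) * P.ηbar + P.aM))) * Δ + (P.A * ρ ^ j) * ε := by
        refine (abs_add_le _ _).trans (add_le_add ?_ ?_)
        · rw [abs_mul]
          refine mul_le_mul (hexp.trans ?_) (hΔ _) (abs_nonneg _) (by positivity)
          exact mul_le_mul_of_nonneg_left hlog (by positivity)
        · rw [abs_mul, abs_of_pos (Real.exp_pos _)]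
          exact mul_le_mul hb2 hδ1 (abs_nonneg _) (by positivity)
    _ = _ := by ring

/-- If a fixed point of `op` moves by at most `D` under a common period away from the instants,
then it moves by at most `θ * D + C * ε`. -/
lemma exists_shift_bound {x : ℝ → ℝ} (hxm : Measurable x) (hx0 : ∀ s, 0 ≤ x s)
    (hfix : P.op x = x) {K : ℝ} (hK0 : 0 ≤ K)
    (hK : ∀ r s, |P.hill (x r) - P.hill (x s)| ≤ K * |x r - x s|) :
    ∃ C, 0 ≤ C ∧ ∀ ε w q, 0 < ε → ε < P.η → ε ≤ 1 → P.IsPeriod ε w q → ∀ D, 0 ≤ D →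
      (∀ s, s ∉ nearInstants P.t ε → |x (s + w) - x s| ≤ D) →
      ∀ s, s ∉ nearInstants P.t ε → |x (s + w) - x s| ≤ P.A * P.bM * K / P.aL * D + C * ε := by
  obtain ⟨Cσ, hCσ0, hCσ⟩ := h.exists_jumpResponse_shift_bound
  have hA := A_pos (P := P)
  have hbM := h.bM_nonneg
  have haL := h.aL_pos
  have hη := h.η_pos
  have hτ := h.τ_nonneg
  set κ := 1 + (1 + 1 / P.η) * (2 / P.aL) with hκ
  have hκ0 : 0 ≤ κ := by positivity
  set β := 2 * Real.exp (P.aL * (P.ηbar + 1)) / (1 - Real.exp (-P.aL * P.η)) with hβ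
  have hρ : 0 < 1 - Real.exp (-P.aL * P.η) := sub_pos.2 h.ratio_lt_one
  have hβ0 : 0 ≤ β := by positivity
  refine ⟨P.A * P.bM * κ * (1 / (P.aL / 2)) + P.A / P.aL + 2 * (P.A * P.bM * β) + Cσ,
    by positivity, fun ε w q hε hεη hε1 hp D hD0 hD s hs => ?_⟩
  have hnear : ∀ s', ∫ r in Iic s', P.nearWeight ε s' r ≤ β * ε := fun s' => by
    refine (h.integral_nearWeight_le hε hεη s').trans ?_
    calc _ ≤ 2 * ε * Real.exp (P.aL * (P.ηbar + 1)) / (1 - Real.exp (-P.aL * P.η)) := by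
          gcongr
      _ = _ := by rw [hβ]; ring
  have hnn : ∀ s' r, 0 ≤ P.nearWeight ε s' r := fun s' r =>
    indicator_nonneg (fun _ _ => (Real.exp_pos _).le) r
  have hshift : ∀ r, P.nearWeight ε (s - P.τ) (r - P.τ) = P.nearWeight ε (s - P.τ) (r + -P.τ) :=
    fun r => by rw [sub_eq_add_neg r]
  have i1 := integrableOn_exp_neg_mul_sub (half_pos haL) s
  have i2 := integrableOn_exp_neg_mul_sub haL s
  have i3 := h.integrableOn_nearWeight ε s
  have i4 : MeasureTheory.IntegrableOn (fun r => P.nearWeight ε (s - P.τ) (r - P.τ)) (Iic s) := by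
    simp_rw [hshift]
    refine integrableOn_Iic_comp_add_right (f := P.nearWeight ε (s - P.τ)) ?_
    rw [← sub_eq_add_neg]
    exact h.integrableOn_nearWeight ε _
  have v4 : ∫ r in Iic s, P.nearWeight ε (s - P.τ) (r - P.τ) ≤ β * ε := by
    simp_rw [hshift]
    rw [setIntegral_Iic_comp_add_right (P.nearWeight ε (s - P.τ)) s (-P.τ), ← sub_eq_add_neg]
    exact hnear _
  have j1 := i1.const_mul (P.A * P.bM * κ * ε)
  have j2 := i2.const_mul (P.A * ε + P.A * P.bM * K * D)
  have j3 := i3.const_mul (P.A * P.bM)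
  have j4 := i4.const_mul (P.A * P.bM)
  have hw : MeasureTheory.IntegrableOn
      (fun r => Real.exp (P.logFund (s + w) - P.logFund (r + w)) * P.feed x (r + w)) (Iic s) :=
    integrableOn_Iic_comp_add_right (h.integrableOn_weight_feed hxm hx0 (s + w))
  have e1 : x (s + w) - x s = (∫ r in Iic s,
      (Real.exp (P.logFund (s + w) - P.logFund (r + w)) * P.feed x (r + w) -
        Real.exp (P.logFund s - P.logFund r) * P.feed x r)) +
      (P.jumpResponse (s + w) - P.jumpResponse s) := by
    rw [MeasureTheory.integral_sub hw (h.integrableOn_weight_feed hxm hx0 s),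
      setIntegral_Iic_comp_add_right
        (fun r => Real.exp (P.logFund (s + w) - P.logFund r) * P.feed x r)]
    conv_lhs => rw [← hfix]
    unfold op
    ring
  have hpt : ∀ r ∈ Iic s, ‖Real.exp (P.logFund (s + w) - P.logFund (r + w)) * P.feed x (r + w) -
        Real.exp (P.logFund s - P.logFund r) * P.feed x r‖ ≤
      P.A * P.bM * κ * ε * Real.exp (-(P.aL / 2) * (s - r)) +
      (P.A * ε + P.A * P.bM * K * D) * Real.exp (-P.aL * (s - r)) +
      P.A * P.bM * P.nearWeight ε s r +
      P.A * P.bM * P.nearWeight ε (s - P.τ) (r - P.τ) := by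
    intro r hr
    have hsr : 0 ≤ s - r := sub_nonneg.2 hr
    have w1 : Real.exp (P.logFund (s + w) - P.logFund (r + w)) ≤
        P.A * Real.exp (-P.aL * (s - r)) := by
      have := h.weight_le (add_le_add_left (show r ≤ s from hr) w)
      rwa [add_sub_add_right_eq_sub] at this
    have w2 := h.weight_le (show r ≤ s from hr)
    have hwd : |Real.exp (P.logFund (s + w) - P.logFund (r + w)) -
        Real.exp (P.logFund s - P.logFund r)| ≤
        P.A * κ * ε * Real.exp (-(P.aL / 2) * (s - r)) + P.A * P.nearWeight ε s r := by
      -- Near an instant the shifted index is not controlled, so the two weights are bounded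
      -- separately and the loss is charged to `nearWeight`.
      by_cases hrn : r ∈ nearInstants P.t ε
      · have h1 : |Real.exp (P.logFund (s + w) - P.logFund (r + w)) -
            Real.exp (P.logFund s - P.logFund r)| ≤ P.A * Real.exp (-P.aL * (s - r)) := by
          have p1 := Real.exp_pos (P.logFund (s + w) - P.logFund (r + w))
          have p2 := Real.exp_pos (P.logFund s - P.logFund r)
          rw [abs_le]
          constructor <;> linarith
        have h2 : P.nearWeight ε s r = Real.exp (-P.aL * (s - r)) := indicator_of_mem hrn _
        rw [h2]
        refine h1.trans (le_add_of_nonneg_left (by positivity))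
      · refine (abs_exp_sub_exp_le w1 w2).trans ?_
        have h1 := h.abs_logFund_shift_le hε hp hr hrn hs
        have h2 := mul_exp_neg_le (v := s - r) haL
        have h3 : Real.exp (-P.aL * (s - r)) ≤ Real.exp (-(P.aL / 2) * (s - r)) :=
          Real.exp_le_exp.2 (by nlinarith)
        have h4 : (1 + (1 + 1 / P.η) * (s - r)) * Real.exp (-P.aL * (s - r)) ≤
            κ * Real.exp (-(P.aL / 2) * (s - r)) := by
          have h5 := mul_le_mul_of_nonneg_left h2 (show 0 ≤ 1 + 1 / P.η by positivity)
          rw [hκ]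
          linarith
        calc _ ≤ P.A * Real.exp (-P.aL * (s - r)) * (ε * (1 + (1 + 1 / P.η) * (s - r))) := by
              gcongr
          _ = P.A * ε * ((1 + (1 + 1 / P.η) * (s - r)) * Real.exp (-P.aL * (s - r))) := by ring
          _ ≤ P.A * ε * (κ * Real.exp (-(P.aL / 2) * (s - r))) := by gcongr
          _ = P.A * κ * ε * Real.exp (-(P.aL / 2) * (s - r)) := by ring
          _ ≤ _ := le_add_of_nonneg_right (mul_nonneg hA.le (hnn _ _))
    have hfd : Real.exp (-P.aL * (s - r)) * |P.feed x (r + w) - P.feed x r| ≤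
        (ε + P.bM * K * D) * Real.exp (-P.aL * (s - r)) +
          P.bM * P.nearWeight ε (s - P.τ) (r - P.τ) := by
      have h1 : |P.feed x (r + w) - P.feed x r| ≤
          ε + P.bM * |P.hill (x (r - P.τ + w)) - P.hill (x (r - P.τ))| := by
        rw [feed_eq, feed_eq, show r + w - P.τ = r - P.τ + w by ring]
        calc _ = |(P.b (r + w) - P.b r) * P.hill (x (r - P.τ + w)) +
              P.b r * (P.hill (x (r - P.τ + w)) - P.hill (x (r - P.τ)))| := by congr 1; ring
          _ ≤ ε * 1 + P.bM * |P.hill (x (r - P.τ + w)) - P.hill (x (r - P.τ))| := by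
              refine (abs_add_le _ _).trans (add_le_add ?_ ?_)
              · rw [abs_mul, abs_of_pos (hill_pos (hx0 _))]
                exact mul_le_mul (hp.snd r).le (hill_le_one (hx0 _)) (hill_pos (hx0 _)).le hε.le
              · rw [abs_mul, abs_of_nonneg (h.b_nonneg r)]
                exact mul_le_mul_of_nonneg_right (h.le_bM r) (abs_nonneg _)
          _ = _ := by rw [mul_one]
      -- The bound `D` is unavailable when the delayed time is near an instant; there the Hill
      -- values differ by at most `1`, again charged to a `nearWeight`, translated by `τ`.
      by_cases hrn : r - P.τ ∈ nearInstants P.t ε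
      · have h2 : P.nearWeight ε (s - P.τ) (r - P.τ) = Real.exp (-P.aL * (s - r)) := by
          unfold nearWeight
          rw [indicator_of_mem hrn]
          congr 2
          ring
        have h3 := abs_hill_sub_le_one (P := P) (hx0 (r - P.τ + w)) (hx0 (r - P.τ))
        have h4 := mul_le_mul_of_nonneg_left h3 hbM
        rw [h2, ← add_mul, mul_comm]
        have : 0 ≤ P.bM * K * D := by positivity
        exact mul_le_mul_of_nonneg_right (by linarith) (Real.exp_pos _).le
      · have h3 := (hK (r - P.τ + w) (r - P.τ)).trans
          (mul_le_mul_of_nonneg_left (hD _ hrn) hK0)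
        have h4 := mul_le_mul_of_nonneg_left h3 hbM
        rw [mul_comm]
        refine (mul_le_mul_of_nonneg_right (by linarith) (Real.exp_pos _).le).trans
          (le_add_of_nonneg_right (mul_nonneg hbM (hnn _ _)))
    have hf := h.abs_feed_le (x := x) (s := r + w) (hx0 _)
    rw [Real.norm_eq_abs]
    calc _ = |(Real.exp (P.logFund (s + w) - P.logFund (r + w)) -
            Real.exp (P.logFund s - P.logFund r)) * P.feed x (r + w) +
            Real.exp (P.logFund s - P.logFund r) * (P.feed x (r + w) - P.feed x r)| := by
          congr 1; ring
      _ ≤ (P.A * κ * ε * Real.exp (-(P.aL / 2) * (s - r)) + P.A * P.nearWeight ε s r) * P.bM +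
          P.A * ((ε + P.bM * K * D) * Real.exp (-P.aL * (s - r)) +
          P.bM * P.nearWeight ε (s - P.τ) (r - P.τ)) := by
          refine (abs_add_le _ _).trans (add_le_add ?_ ?_)
          · rw [abs_mul]
            exact mul_le_mul hwd hf (abs_nonneg _) (add_nonneg (by positivity)
              (mul_nonneg hA.le (hnn _ _)))
          · rw [abs_mul, abs_of_pos (Real.exp_pos _)]
            refine (mul_le_mul_of_nonneg_right w2 (abs_nonneg _)).trans ?_
            rw [mul_assoc]
            exact mul_le_mul_of_nonneg_left hfd hA.le
      _ = _ := by ring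
  have hint := MeasureTheory.norm_integral_le_of_norm_le (((j1.fun_add j2).fun_add j3).fun_add j4)
    ((MeasureTheory.ae_restrict_iff' measurableSet_Iic).2 (MeasureTheory.ae_of_all _ hpt))
  have hval : ∫ r in Iic s, (P.A * P.bM * κ * ε * Real.exp (-(P.aL / 2) * (s - r)) +
      (P.A * ε + P.A * P.bM * K * D) * Real.exp (-P.aL * (s - r)) +
      P.A * P.bM * P.nearWeight ε s r +
      P.A * P.bM * P.nearWeight ε (s - P.τ) (r - P.τ)) ≤
      P.A * P.bM * κ * ε * (1 / (P.aL / 2)) + (P.A * ε + P.A * P.bM * K * D) * (1 / P.aL) +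
        P.A * P.bM * (β * ε) + P.A * P.bM * (β * ε) := by
    rw [MeasureTheory.integral_add ((j1.fun_add j2).fun_add j3) j4,
      MeasureTheory.integral_add (j1.fun_add j2) j3, MeasureTheory.integral_add j1 j2,
      MeasureTheory.integral_const_mul, MeasureTheory.integral_const_mul,
      MeasureTheory.integral_const_mul, MeasureTheory.integral_const_mul,
      integral_exp_neg_mul_sub (half_pos haL), integral_exp_neg_mul_sub haL]
    have := hnear s
    gcongr
  have hσ := hCσ ε w q hε hp s hs
  rw [e1]
  refine (abs_add_le _ _).trans ((add_le_add (hint.trans hval) hσ).trans_eq ?_)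
  ring

/-- Iteration of `D ↦ θ D + C ε` from `D = M₁`, admissible because all values lie in `[0, M₁]`; its
fixed point is `C ε / (1 - θ)`. -/
lemma exists_shift_bound_linear {x : ℝ → ℝ} (hxm : Measurable x)
    (hxI : ∀ s, x s ∈ Icc P.M₂ P.M₁) (hM₂ : 0 < P.M₂) (hfix : P.op x = x) {K : ℝ} (hK0 : 0 ≤ K)
    (hK : ∀ r s, |P.hill (x r) - P.hill (x s)| ≤ K * |x r - x s|)
    (hθ : P.A * P.bM * K / P.aL < 1) :
    ∃ C, 0 ≤ C ∧ ∀ ε w q, 0 < ε → ε < P.η → ε ≤ 1 → P.IsPeriod ε w q →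
      ∀ s, s ∉ nearInstants P.t ε → |x (s + w) - x s| ≤ C * ε := by
  obtain ⟨C, hC0, hC⟩ := h.exists_shift_bound hxm (fun s => hM₂.le.trans (hxI s).1) hfix hK0 hK
  set θ := P.A * P.bM * K / P.aL
  have hθ0 : 0 ≤ θ := div_nonneg (mul_nonneg (mul_nonneg A_pos.le h.bM_nonneg) hK0) h.aL_pos.le
  have h1θ : 0 < 1 - θ := sub_pos.2 hθ
  have hM := h.M₁_nonneg
  refine ⟨C / (1 - θ), by positivity, fun ε w q hε hεη hε1 hp s hs => ?_⟩
  have key : ∀ n : ℕ, ∀ s, s ∉ nearInstants P.t ε →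
      |x (s + w) - x s| ≤ θ ^ n * P.M₁ + C / (1 - θ) * ε := by
    intro n
    induction n with
    | zero =>
      intro s _
      have h1 := hxI (s + w)
      have h2 := hxI s
      have h3 : 0 ≤ C / (1 - θ) * ε := by positivity
      rw [pow_zero, one_mul, abs_le]
      constructor <;> linarith [h1.1, h1.2, h2.1, h2.2]
    | succ n ih =>
      intro s hs
      refine (hC ε w q hε hεη hε1 hp _ (by positivity) ih s hs).trans_eq ?_
      field_simp
      ring
  have hlim : Tendsto (fun n : ℕ => θ ^ n * P.M₁ + C / (1 - θ) * ε) atTop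
      (𝓝 (0 * P.M₁ + C / (1 - θ) * ε)) :=
    ((tendsto_pow_atTop_nhds_zero_of_lt_one hθ0 hθ).mul_const _).add_const _
  rw [zero_mul, zero_add] at hlim
  exact ge_of_tendsto' hlim fun n => key n s hs

/-! ### Almost periodicity of the fixed point. -/

lemma log_ap : SeqAP fun k => Real.log (1 + P.γ k) :=
  h.γ_ap.log_one_add (m := 1 + P.γL) (by linarith [h.γL_gt]) h.γL_le

/-- Within one interval between instants `jumpResponse` solves the homogeneous equation, so it drops
out of the variation of constants formula. -/
lemma mild_lipschitz {t₀ M : ℝ} {x : ℝ → ℝ} (hx : P.IsMild t₀ x) (hM : ∀ s, x s ≤ M) {r s : ℝ}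
    (hr : t₀ ≤ r) (hrs : r ≤ s) (hidx : P.idx r = P.idx s) :
    |x s - x r| ≤ (P.aM * M + P.A * P.bM) * (s - r) := by
  have hτ := h.τ_nonneg
  have h1 := hx.formula r s hr hrs
  have hσ : P.jumpResponse s = Real.exp (P.logFund s - P.logFund r) * P.jumpResponse r := by
    rw [jumpResponse_eq, jumpResponse_eq, hidx, ← mul_assoc, ← Real.exp_add, sub_add_cancel]
  have h2 : x s - x r = (Real.exp (P.logFund s - P.logFund r) - 1) * x r +
      ∫ u in r..s, Real.exp (P.logFund s - P.logFund u) * P.feed x u := by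
    linear_combination h1 + hσ
  have hlog : P.logFund s - P.logFund r = -∫ u in r..s, P.a u := by
    rw [logFund, logFund, hidx, ← h.int_a_sub r s]
    ring
  have h3 : |Real.exp (P.logFund s - P.logFund r) - 1| ≤ P.aM * (s - r) := by
    have h4 := h.int_a_le hrs
    have h5 := h.le_int_a hrs
    have h6 := Real.add_one_le_exp (P.logFund s - P.logFund r)
    have h7 : 0 ≤ P.aL * (s - r) := mul_nonneg h.aL_pos.le (sub_nonneg.2 hrs)
    have h8 : Real.exp (P.logFund s - P.logFund r) ≤ 1 := Real.exp_le_one_iff.2 (by linarith)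
    rw [abs_le]
    constructor <;> linarith
  have h9 : ‖∫ u in r..s, Real.exp (P.logFund s - P.logFund u) * P.feed x u‖ ≤
      P.A * P.bM * |s - r| := by
    refine intervalIntegral.norm_integral_le_of_norm_le_const fun u hu => ?_
    rw [uIoc_of_le hrs] at hu
    have hu0 := hx.nonneg (u - P.τ) (by linarith [hu.1])
    rw [norm_mul, Real.norm_of_nonneg (Real.exp_pos _).le]
    refine mul_le_mul ((h.weight_le hu.2).trans ?_) (h.abs_feed_le hu0) (norm_nonneg _) A_pos.le
    refine mul_le_of_le_one_right A_pos.le (Real.exp_le_one_iff.2 ?_)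
    have := mul_nonneg h.aL_pos.le (sub_nonneg.2 hu.2)
    linarith
  rw [abs_of_nonneg (sub_nonneg.2 hrs), Real.norm_eq_abs] at h9
  have hxr := hx.nonneg r (by linarith)
  rw [h2]
  refine (abs_add_le _ _).trans ?_
  rw [abs_mul, abs_of_nonneg hxr]
  have h10 : |Real.exp (P.logFund s - P.logFund r) - 1| * x r ≤ P.aM * (s - r) * M :=
    mul_le_mul h3 (hM r) hxr ((abs_nonneg _).trans h3)
  linarith

lemma piecewiseAP {x : ℝ → ℝ} (hsol : P.IsSolution x) (hmild : ∀ t₀, P.IsMild t₀ x)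
    (hM : ∀ s, x s ≤ P.M₁) {C : ℝ} (hC0 : 0 ≤ C)
    (hC : ∀ ε w q, 0 < ε → ε < P.η → ε ≤ 1 → P.IsPeriod ε w q →
      ∀ s, s ∉ nearInstants P.t ε → |x (s + w) - x s| ≤ C * ε) :
    PiecewiseAP P.t x where
  plc := hsol.plc
  instants := h.t_ap
  unif_cont ε hε := by
    set Λ := P.aM * P.M₁ + P.A * P.bM
    have hΛ : 0 ≤ Λ := add_nonneg (mul_nonneg h.aM_pos.le h.M₁_nonneg)
      (mul_nonneg A_pos.le h.bM_nonneg)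
    have key : ∀ k : ℤ, ∀ s ∈ Ioc (P.t k) (P.t (k + 1)), ∀ s' ∈ Ioc (P.t k) (P.t (k + 1)),
        s ≤ s' → |x s' - x s| ≤ Λ * |s' - s| := by
      intro k s hs s' hs' hss
      rw [abs_of_nonneg (sub_nonneg.2 hss)]
      refine h.mild_lipschitz (hmild s) hM le_rfl hss ?_
      rw [h.idx_eq (k := k + 1) (by simpa using hs.1) hs.2,
        h.idx_eq (k := k + 1) (by simpa using hs'.1) hs'.2]
    refine ⟨ε / (Λ + 1), by positivity, fun k s hs s' hs' hd => ?_⟩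
    rw [lt_div_iff₀ (by positivity)] at hd
    have h0 := abs_nonneg (s - s')
    rcases le_total s s' with hss | hss
    · have := key k s hs s' hs' hss
      rw [abs_sub_comm, abs_sub_comm s' s] at this
      linarith
    · have := key k s' hs' s hs hss
      linarith
  almost_periods ε hε := by
    -- Being at most `ε`, it keeps points far from the instants admissible; `η / 2` and `1` meet the
    -- conditions of the shift bound; the last term makes `C * ε₁ < ε`.
    set ε₁ := min (min ε (P.η / 2)) (min 1 (ε / (2 * (C + 1))))
    have hη := h.η_pos
    have hε₁ : 0 < ε₁ := by positivity
    have h1 : ε₁ ≤ ε := (min_le_left _ _).trans (min_le_left _ _)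
    have h2 : ε₁ ≤ P.η / 2 := (min_le_left _ _).trans (min_le_right _ _)
    have h3 : ε₁ ≤ 1 := (min_le_right _ _).trans (min_le_left _ _)
    have h4 : ε₁ ≤ ε / (2 * (C + 1)) := (min_le_right _ _).trans (min_le_right _ _)
    rw [le_div_iff₀ (by positivity)] at h4
    obtain ⟨l, hl, hd⟩ := relDense_commonPeriod h.t_ap h.a_ap h.b_ap h.log_ap h.δ_ap
      h.ηbar_pos.le h.exists_t_mem hε₁
    refine ⟨l, hl, fun u => ?_⟩
    obtain ⟨w, ⟨q, hq⟩, hw⟩ := hd u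
    refine ⟨w, fun s hs => ?_, hw⟩
    have := hC ε₁ w q hε₁ (by linarith) h3 hq s
      (notMem_nearInstants.2 fun k => h1.trans_lt (hs k))
    have : 0 ≤ C * ε₁ := by positivity
    linarith

/-! ### Uniqueness. -/

/-- Almost periodic positive solutions satisfy the upper bound `M₁`. -/
lemma le_M₁_of_isPositiveAPSolution {y : ℝ → ℝ} (hy : P.IsPositiveAPSolution y) (s : ℝ) :
    y s ≤ P.M₁ := by
  obtain ⟨hsol, hap, hpos⟩ := hy
  obtain ⟨S, hS0, hS⟩ := h.exists_jumpResponse_bound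
  -- Almost periods control the solution only away from the instants, so the recurring value is
  -- taken at a point `s₀` that is not an instant.
  obtain ⟨s₀, hs₀⟩ : ∃ s₀, s₀ ∉ range P.t := by
    have h1 : P.t 0 < P.t 1 := h.t_strictMono (by omega)
    obtain ⟨s₀, h2, h3⟩ := exists_between h1
    refine ⟨s₀, ?_⟩
    rintro ⟨k, rfl⟩
    have := h.t_strictMono.lt_iff_lt.1 h2
    have := h.t_strictMono.lt_iff_lt.1 h3
    omega
  obtain ⟨ε, hε, hgap⟩ : ∃ ε, 0 < ε ∧ ∀ k, ε < |s₀ - P.t k| := by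
    obtain ⟨h1, h2⟩ := h.idx_spec s₀
    have h3 : s₀ < P.t (P.idx s₀) := h2.lt_of_ne fun e => hs₀ ⟨_, e.symm⟩
    set m := min (s₀ - P.t (P.idx s₀ - 1)) (P.t (P.idx s₀) - s₀)
    have hm : 0 < m := lt_min (sub_pos.2 h1) (sub_pos.2 h3)
    refine ⟨m / 2, half_pos hm, fun k => (half_lt_self hm).trans_le ?_⟩
    rcases lt_or_ge k (P.idx s₀) with hk | hk
    · have := h.t_strictMono.monotone (show k ≤ P.idx s₀ - 1 by omega)
      exact (min_le_left _ _).trans (le_trans (by linarith) (le_abs_self _))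
    · have := h.t_strictMono.monotone hk
      exact (min_le_right _ _).trans (le_trans (by linarith) (neg_le_abs _))
  obtain ⟨l, hl, hw⟩ := hap.almost_periods ε hε
  refine le_of_forall_pos_le_add fun e he => ?_
  obtain ⟨T, hT0, hT⟩ := exists_mul_exp_neg_le h.aL_pos (P.A * (y s₀ + ε + S)) he
  -- This choice gives `s₀ + w ≤ s - T`, where `y` is below `y s₀ + ε`; the transient in
  -- `mild_upper` has then decayed below `e` at time `s`.
  obtain ⟨w, hwS, -, hw2⟩ := hw (s - s₀ - T - l)
  have h1 := (abs_lt.1 (hwS s₀ hgap)).2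
  have h2 := h.mild_upper (h.isMild (hsol.isSolutionFrom (hpos (s₀ + w)))) hS
    (show s₀ + w ≤ s by linarith)
  have h3 := hT (s - (s₀ + w)) (by linarith)
  refine h2.trans (add_le_add_right (le_trans ?_ h3) _)
  have hA := A_pos (P := P)
  calc P.A * Real.exp (-P.aL * (s - (s₀ + w))) * (y (s₀ + w) + S)
      ≤ P.A * Real.exp (-P.aL * (s - (s₀ + w))) * (y s₀ + ε + S) := by
        gcongr; linarith
    _ = _ := by ring

/-- Both solutions lie in `(0, M₁]`, so the initial deviation at time `s - T` is at most `M₁` for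
every `T`, and its effect at time `s` vanishes as `T → ∞`. -/
lemma eq_of_isExpStable {x y : ℝ → ℝ} (hx : P.IsPositiveAPSolution x)
    (hy : P.IsPositiveAPSolution y) (hst : P.IsExpStable x) : y = x := by
  obtain ⟨C, c, hC, hc, hst⟩ := hst
  ext s
  have hb : ∀ u, |y u - x u| ≤ P.M₁ := fun u => by
    have h1 := h.le_M₁_of_isPositiveAPSolution hx u
    have h2 := h.le_M₁_of_isPositiveAPSolution hy u
    have h3 := hx.2.2 u
    have h4 := hy.2.2 u
    rw [abs_le]
    constructor <;> linarith
  refine eq_of_abs_sub_eq_zero (le_antisymm (le_of_forall_pos_le_add fun e he => ?_)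
    (abs_nonneg _))
  obtain ⟨T, hT0, hT⟩ := exists_mul_exp_neg_le hc (C * P.M₁) he
  have h1 := hst (s - T) y (hy.1.isSolutionFrom (hy.2.2 _)) P.M₁ (fun u _ => hb u) s (by linarith)
  rw [sub_sub_cancel] at h1
  rw [zero_add]
  exact h1.trans (hT T le_rfl)

/-! ### The contraction constant and the conclusion. -/

lemma lip_le_Kstar (hM₂ : 0 < P.M₂) (hM : P.M₂ ≤ P.M₁) : P.lip P.M₂ P.M₁ ≤ P.Kstar := by
  have hα := h.α_pos
  -- Boundedness is needed for `Kstar` to be a genuine supremum; the supremum of an unbounded set is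
  -- `0` by convention.
  have hbdd : BddAbove ((fun x : ℝ => P.α * x ^ (P.α - 1)) '' Icc P.M₂ P.M₁) := by
    refine ⟨P.lip P.M₂ P.M₁, ?_⟩
    rintro _ ⟨v, hv, rfl⟩
    exact mul_le_mul_of_nonneg_left (rpow_sub_one_le_max hM₂ hv _) hα.le
  unfold lip
  rw [mul_max_of_nonneg _ _ hα.le]
  exact max_le (le_csSup hbdd ⟨_, left_mem_Icc.2 hM, rfl⟩)
    (le_csSup hbdd ⟨_, right_mem_Icc.2 hM, rfl⟩)

lemma contraction_lt_one (hM₂ : 0 < P.M₂)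
    (hK : 1 / P.aL * max P.A (P.γL + 1)⁻¹ * P.bM * P.Kstar < 1) :
    P.A * P.bM * P.lip P.M₂ P.M₁ / P.aL < 1 := by
  refine lt_of_le_of_lt ?_ hK
  have h1 := h.lip_le_Kstar hM₂ h.M₂_le_M₁
  have h2 := h.lip_nonneg (M := P.M₁) hM₂
  have h3 := h.aL_pos
  have h4 := h.bM_nonneg
  have h5 := A_pos (P := P)
  calc P.A * P.bM * P.lip P.M₂ P.M₁ / P.aL = 1 / P.aL * P.A * P.bM * P.lip P.M₂ P.M₁ := by ring
    _ ≤ 1 / P.aL * max P.A (P.γL + 1)⁻¹ * P.bM * P.Kstar := by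
        gcongr
        exact le_max_left _ _

end Admissible
end HematopoiesisModel
end

theorem corollary3p4 (P : HematopoiesisModel)
    (hτ : 0 ≤ P.τ) (hα : 0 < P.α)
    (ha : BohrAP P.a) (haL : 0 < P.aL)
    (hb : BohrAP P.b) (hb0 : ∀ s, 0 ≤ P.b s)
    (hδ : SeqAP P.δ)
    (hγ : SeqAP P.γ) (hγL : -1 < P.γL)
    (hΓM : BddAbove P.gammaProducts) (hΓL : 0 < P.ΓL)
    (ht : UniformlyAP P.t) (hη : 0 < P.η)
    (hM₂ : 0 < P.M₂) (hτη : P.τ ≤ P.η)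
    (hK : 1 / P.aL * max P.A (P.γL + 1)⁻¹ * P.bM * P.Kstar < 1) :
    ∃ x : ℝ → ℝ, P.IsPositiveAPSolution x ∧
      (∀ y : ℝ → ℝ, P.IsPositiveAPSolution y → y = x) ∧
      P.IsExpStable x := by
  have h : P.Admissible := ⟨hτ, hα, ha, haL, hb, hb0, hδ, hγ, hγL, hΓM, hΓL, ht, hη⟩
  have hθ := h.contraction_lt_one hM₂ hK
  have hlip0 := h.lip_nonneg (M := P.M₁) hM₂
  obtain ⟨x, hxm, hxI, hfix⟩ := h.exists_fixed_point hM₂ hlip0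
    (fun u hu v hv => h.hill_lip hM₂ hu hv)
    (lt_of_eq_of_lt (by ring) hθ)
  have hpos : ∀ s, 0 < x s := fun s => hM₂.trans_le (hxI s).1
  have hsol := h.isSolution_of_fixed_point hxm (fun s => (hpos s).le) hfix
  have hmild : ∀ t₀, P.IsMild t₀ x := fun t₀ => h.isMild (hsol.isSolutionFrom (hpos t₀))
  obtain ⟨C, hC0, hC⟩ := h.exists_shift_bound_linear hxm hxI hM₂ hfix hlip0
    (fun r s => h.hill_lip hM₂ (hxI r) (hxI s)) hθ
  have hap : P.IsPositiveAPSolution x :=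
    ⟨hsol, h.piecewiseAP hsol hmild (fun s => (hxI s).2) hC0 hC, hpos⟩
  have hst := h.isExpStable hmild hxI hM₂ hθ
  exact ⟨x, hap, fun y hy => h.eq_of_isExpStable hap hy hst, hst⟩
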